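/- Let $n\ge 1$, $\beta\ge 0$, $h\in\mathbb R$, and consider the Curie–Weiss model on $\{-1,1\}^n$, $\pi^n(x)\propto \exp\{\beta n(\tfrac12 m^2+hm)\}$ with magnetization $m=\frac1n\sum_i x_i$. Let $m_0$ satisfy $m_0=\tanh(\beta(m_0+h))$, let $\gamma\in\{\tfrac14,\tfrac12\}$, and put $\eta=n^{\gamma}(m-m_0)$. The Metropolis–Hastings magnetization chain is the Markov chain on the $n+1$ possible values of $\eta$ with transition probabilities $$P^n(\eta,\eta\pm 2n^{\gamma-1})=\tfrac12\bigl[1\mp(m_0+n^{-\gamma}\eta)\bigr]\Bigl(1\wedge e^{\beta(\Phi^n(\eta)-\Phi^n(\eta\pm2n^{\gamma-1}))}\Bigr),\qquad \Phi^n(\eta)=-\tfrac12n^{1-2\gamma}\eta^2-n^{1-\gamma}(m_0+h)\eta ,$$ which otherwise stays put. Let $X(\infty)=X^n(\infty)$ be distributed according to its stationary law. A probability measure $\nu$ on $\mathbb R$ is called a stationary law of the diffusion with generator $G$ if $\int Gf\,d\nu=0$ for all $f\in C_c^\infty(\mathbb R)$; let $Y(\infty)$ be distributed according to the stationary law of the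 limiting diffusion given below. In both cases below the two stationary laws exist and are unique, and the following bounds hold. 1. (Critical case) Let $\beta=1$, $h=0$, $m_0=0$, $\gamma=\frac14$ and $Gf(x)=2f''(x)-\frac23x^3f'(x)$. There is a constant $C$ such that for all $n\ge1$ and all bounded Lipschitz functions $\varphi:\mathbb R\to\mathbb R$ with $|\varphi|\le M$ and Lipschitz constant $K$, $$\bigl|E[\varphi(X(\infty))]-E[\varphi(Y(\infty))]\bigr|\le \frac{C\,(M+K)}{n^{1/4}} .$$ 2. (Supercritical case) Let $0\le\beta<1$, $h\in\mathbb R$, $\gamma=\frac12$ and $Gf(x)=2(1-|m_0|)f''(x)-2(1-|m_0|)\bigl(\frac1{1-m_0^2}-\beta\bigr)x\,f'(x)$. There is a constant $C$, depending only on $\beta$ and $h$, such that for all $n\ge1$ and all $\varphi$, $M$, $K$ as above, $$\bigl|E[\varphi(X(\infty))]-E[\varphi(Y(\infty))]\bigr|\le \frac{C\,(M+K)}{n^{1/2}} .$$ -/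

import Mathlib

open MeasureTheory
open scoped Matrix NNReal ContDiff

noncomputable section

namespace CurieWeiss

/-- The magnetization `(1/n) ∑ xᵢ` of a configuration `x ∈ {-1, 1}ⁿ` with exactly `k` spins `+1`.
Its possible values are indexed by `k = 0, …, n`. -/
def magnetization (n : ℕ) (k : Fin (n + 1)) : ℝ := (2 * ((k : ℕ) : ℝ) - n) / n

/-- The centered and rescaled magnetization `η = n^γ (m - m₀)`. -/
def eta (γ m₀ : ℝ) (n : ℕ) (k : Fin (n + 1)) : ℝ :=
  (n : ℝ) ^ γ * (magnetization n k - m₀)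

/-- The energy in terms of `η`, up to an additive constant: with `m = m₀ + n^{-γ} η` it differs
from `-n (m² / 2 + field * m)` by a term that does not depend on `η`. -/
def Phi (γ m₀ field : ℝ) (n : ℕ) (η : ℝ) : ℝ :=
  -(1 / 2) * (n : ℝ) ^ (1 - 2 * γ) * η ^ 2 - (n : ℝ) ^ (1 - γ) * (m₀ + field) * η

/-- The step `2 n^{γ-1}` of the rescaled magnetization when one spin is flipped. -/
def step (γ : ℝ) (n : ℕ) : ℝ := 2 * (n : ℝ) ^ (γ - 1)

/-- Probability that a uniformly chosen spin is `-1`: the proposal `η → η + 2 n^{γ-1}`. -/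
def proposalUp (γ m₀ : ℝ) (n : ℕ) (η : ℝ) : ℝ := (1 - (m₀ + (n : ℝ) ^ (-γ) * η)) / 2

/-- Probability that a uniformly chosen spin is `+1`: the proposal `η → η - 2 n^{γ-1}`. -/
def proposalDown (γ m₀ : ℝ) (n : ℕ) (η : ℝ) : ℝ := (1 + (m₀ + (n : ℝ) ^ (-γ) * η)) / 2

/-- Metropolis–Hastings probability of the move `η → η + 2 n^{γ-1}`. -/
def pUp (γ m₀ β field : ℝ) (n : ℕ) (η : ℝ) : ℝ :=
  proposalUp γ m₀ n η *
    min 1 (Real.exp (β * (Phi γ m₀ field n η - Phi γ m₀ field n (η + step γ n))))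

/-- Metropolis–Hastings probability of the move `η → η - 2 n^{γ-1}`. -/
def pDown (γ m₀ β field : ℝ) (n : ℕ) (η : ℝ) : ℝ :=
  proposalDown γ m₀ n η *
    min 1 (Real.exp (β * (Phi γ m₀ field n η - Phi γ m₀ field n (η - step γ n))))

/-- Transition matrix of the Metropolis–Hastings chain of the rescaled magnetization; the state
`eta γ m₀ n k` is represented by its index `k`. -/
def transition (γ m₀ β field : ℝ) (n : ℕ) : Matrix (Fin (n + 1)) (Fin (n + 1)) ℝ :=
  fun i j =>
    if (j : ℕ) = i + 1 then pUp γ m₀ β field n (eta γ m₀ n i)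
    else if (i : ℕ) = j + 1 then pDown γ m₀ β field n (eta γ m₀ n i)
    else if i = j then
      1 - pUp γ m₀ β field n (eta γ m₀ n i) - pDown γ m₀ β field n (eta γ m₀ n i)
    else 0

/-- `p` is a stationary distribution of the finite Markov chain with transition matrix `P`. -/
def IsStationaryDist {ι : Type*} [Fintype ι] (P : Matrix ι ι ℝ) (p : ι → ℝ) : Prop :=
  p ∈ stdSimplex ℝ ι ∧ p ᵥ* P = p

/-- Generator of the one-dimensional diffusion `dY = b(Y) dt + √(a(Y)) dB`. -/
def generator (a b : ℝ → ℝ) (f : ℝ → ℝ) (x : ℝ) : ℝ :=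
  a x / 2 * deriv (deriv f) x + b x * deriv f x

/-- `ν` is a stationary law of the diffusion with generator `generator a b`: a probability measure
with `∫ G f dν = 0` for all smooth compactly supported `f`. -/
def IsStationaryLaw (a b : ℝ → ℝ) (ν : Measure ℝ) : Prop :=
  IsProbabilityMeasure ν ∧
    ∀ f : ℝ → ℝ, ContDiff ℝ ∞ f → HasCompactSupport f → ∫ x, generator a b f x ∂ν = 0

/-- Critical limit, `G f = 2 f'' - (2/3) x³ f'`. -/
def criticalDiffusivity (_x : ℝ) : ℝ := 4

/-- Drift of the critical limit. -/
def criticalDrift (x : ℝ) : ℝ := -(2 / 3) * x ^ 3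

/-- Supercritical limit,
`G f = 2 (1 - |m₀|) f'' - 2 (1 - |m₀|) (1 / (1 - m₀²) - β) x f'`. -/
def supercriticalDiffusivity (m₀ : ℝ) (_x : ℝ) : ℝ := 4 * (1 - |m₀|)

/-- Drift of the supercritical limit. -/
def supercriticalDrift (β m₀ : ℝ) (x : ℝ) : ℝ :=
  -2 * (1 - |m₀|) * (1 / (1 - m₀ ^ 2) - β) * x

end CurieWeiss

end

noncomputable section

namespace CurieWeiss

open Set Filter Topology

/-! ### Primitives -/

/-! The proof is Stein's method, applied to stationary laws only. Both limiting generators have the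
form `σ (f'' - V' f')` with `V` an even monomial, `x ^ 4 / 12` or `s x ^ 2 / 2` where `s = 1 / (1 -
m₀ ^ 2) - β`. Their unique stationary law is the probability measure proportional to `exp (-V)`,
whatever the time scale `σ ≠ 0` (`isStationaryLaw_iff`). For `φ` bounded and continuous, the
equation `g' - V' g = φ - ∫ φ` has a bounded solution (`exists_stein_solution`), and the equation
itself then controls the growth and the local oscillation of `g'`.

The stationary law of the chain is given by explicit weights that satisfy detailed balance. The
Metropolis minimum can therefore be discarded: any other rates reversible for the same weights give
a valid identity. The smooth rates `(1 ∓ m) exp (± β (m + field))` yield `∑ p (A g(x + h) - B g(x -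
h)) = 0` with `h` half the lattice step (`stationary_stein_identity`). Since `A - B ≈ -2 κ h V'(x)`
and `A + B ≈ 2 κ`, the summand is close to `2 κ h (g' - V' g)(x)`, which is `2 κ h (φ(x) - ∫ φ)`.
`stein_comparison` turns this into the bound, given Taylor estimates on the rates and a moment bound
uniform in `n`. The moments come from the same identity with `g = x ^ 3` (critical) or `g = x`
(supercritical), because the drift is dissipative on the whole line. -/

lemma hasDerivAt_integral_Iic {u : ℝ → ℝ} (hu : Continuous u) (hi : Integrable u) (x : ℝ) :
    HasDerivAt (fun y => ∫ t in Iic y, u t) (u x) x := by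
  have h : (fun y => ∫ t in Iic y, u t) = fun y => (∫ t in (0 : ℝ)..y, u t) + ∫ t in Iic 0, u t := by
    funext y
    rw [← intervalIntegral.integral_Iic_sub_Iic hi.integrableOn hi.integrableOn, sub_add_cancel]
  rw [h]
  exact (hu.integral_hasStrictDerivAt 0 x).hasDerivAt.add_const _

/-- The primitive from `-∞` vanishes to the left of the support of `u` and equals the total
integral, zero, to its right. Derivatives of test functions are thus exactly the test functions of
mean zero. -/
lemma exists_compactSupport_primitive {u : ℝ → ℝ} (hu : ContDiff ℝ ∞ u)
    (hc : HasCompactSupport u) (h0 : ∫ x, u x = 0) :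
    ∃ f : ℝ → ℝ, ContDiff ℝ ∞ f ∧ HasCompactSupport f ∧ deriv f = u := by
  have hi : Integrable u := hu.continuous.integrable_of_hasCompactSupport hc
  have hd := hasDerivAt_integral_Iic hu.continuous hi
  have hderiv : deriv (fun y => ∫ t in Iic y, u t) = u := funext fun x => (hd x).deriv
  obtain ⟨R, hR⟩ := hc.isCompact.isBounded.subset_closedBall (0 : ℝ)
  have hz : ∀ x, R < |x| → u x = 0 := by
    intro x hx
    by_contra hne
    have := hR (subset_tsupport u hne)
    rw [mem_closedBall_zero_iff, Real.norm_eq_abs] at this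
    linarith
  refine ⟨_, contDiff_infty_iff_deriv.2
    ⟨fun x => (hd x).differentiableAt, by rw [hderiv]; exact hu⟩, ?_, hderiv⟩
  refine HasCompactSupport.intro (isCompact_closedBall (0 : ℝ) R) fun x hx => ?_
  rw [mem_closedBall_zero_iff, Real.norm_eq_abs, not_le] at hx
  rcases le_total 0 x with h | h
  · rw [abs_of_nonneg h] at hx
    rw [← h0]
    refine setIntegral_eq_integral_of_forall_compl_eq_zero fun y hy => hz y ?_
    rw [mem_Iic, not_le] at hy
    exact hx.trans (hy.trans_le (le_abs_self y))
  · rw [abs_of_nonpos h] at hx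
    refine setIntegral_eq_zero_of_forall_eq_zero fun y hy => hz y ?_
    rw [mem_Iic] at hy
    have := neg_le_abs y
    linarith

/-! ### The Gibbs measure of an even monomial potential -/

/-- The potential `c x ^ (2 l + 2)`. -/
def potential (c : ℝ) (l : ℕ) (x : ℝ) : ℝ := c * x ^ (2 * l + 2)

/-- The derivative of `potential c l`. -/
def force (c : ℝ) (l : ℕ) (x : ℝ) : ℝ := c * (2 * l + 2) * x ^ (2 * l + 1)

/-- The probability measure with density proportional to `exp (-c x ^ (2 l + 2))`. -/
def gibbs (c : ℝ) (l : ℕ) : Measure ℝ := volume.tilted fun x => -potential c l x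

/-- The normalizing constant of `gibbs c l`. -/
def partition (c : ℝ) (l : ℕ) : ℝ := ∫ x, Real.exp (-potential c l x)

lemma hasDerivAt_potential (c : ℝ) (l : ℕ) (x : ℝ) :
    HasDerivAt (potential c l) (force c l x) x := by
  have h := (hasDerivAt_pow (2 * l + 2) x).const_mul c
  refine h.congr_deriv ?_
  simp only [force]
  push_cast
  ring_nf

lemma contDiff_potential (c : ℝ) (l : ℕ) : ContDiff ℝ ∞ (potential c l) := by
  unfold potential; fun_prop

lemma contDiff_force (c : ℝ) (l : ℕ) : ContDiff ℝ ∞ (force c l) := by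
  unfold force; fun_prop

lemma sq_sub_one_le_pow (l : ℕ) (x : ℝ) : x ^ 2 - 1 ≤ x ^ (2 * l + 2) := by
  have h : x ^ (2 * l + 2) = (x ^ 2) ^ (l + 1) := by rw [← pow_mul]; ring_nf
  rw [h]
  have hx : 0 ≤ x ^ 2 := sq_nonneg x
  rcases le_total 1 (x ^ 2) with h1 | h1
  · have := le_self_pow₀ h1 (Nat.succ_ne_zero l)
    simp only [Nat.succ_eq_add_one] at this
    linarith
  · have : 0 ≤ (x ^ 2) ^ (l + 1) := by positivity
    linarith

lemma integrable_exp_neg_potential {c : ℝ} (hc : 0 < c) (l : ℕ) :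
    Integrable fun x => Real.exp (-potential c l x) := by
  -- Since `x ^ (2 l + 2) ≥ x ^ 2 - 1`, the density is dominated by a Gaussian times `exp c`.
  refine ((integrable_exp_neg_mul_sq hc).const_mul (Real.exp c)).mono'
    ((contDiff_potential c l).continuous.neg.rexp).aestronglyMeasurable (ae_of_all _ fun x => ?_)
  rw [Real.norm_eq_abs, abs_of_pos (Real.exp_pos _), ← Real.exp_add, Real.exp_le_exp, potential]
  nlinarith [sq_sub_one_le_pow l x]

lemma partition_pos {c : ℝ} (hc : 0 < c) (l : ℕ) : 0 < partition c l :=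
  integral_exp_pos (integrable_exp_neg_potential hc l)

lemma isProbabilityMeasure_gibbs {c : ℝ} (hc : 0 < c) (l : ℕ) : IsProbabilityMeasure (gibbs c l) :=
  isProbabilityMeasure_tilted (integrable_exp_neg_potential hc l)

lemma integral_gibbs (c : ℝ) (l : ℕ) (φ : ℝ → ℝ) :
    ∫ x, φ x ∂(gibbs c l) = (∫ x, Real.exp (-potential c l x) * φ x) / partition c l := by
  rw [gibbs, integral_tilted, ← integral_div]
  refine integral_congr_ae (ae_of_all _ fun x => ?_)
  simp only [smul_eq_mul, partition]
  ring

lemma generator_const (σ c : ℝ) (l : ℕ) (f : ℝ → ℝ) (x : ℝ) :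
    generator (fun _ => 2 * σ) (fun x => -σ * force c l x) f x
      = σ * (deriv (deriv f) x - force c l x * deriv f x) := by
  simp only [generator]; ring

/-- Against the density `exp (-V)` the generator is a total derivative: `exp (-V) (f'' - V' f') =
(exp (-V) f')'`. -/
theorem isStationaryLaw_gibbs (σ : ℝ) {c : ℝ} (hc : 0 < c) (l : ℕ) :
    IsStationaryLaw (fun _ => 2 * σ) (fun x => -σ * force c l x) (gibbs c l) := by
  refine ⟨isProbabilityMeasure_gibbs hc l, fun f hf hcs => ?_⟩
  simp only [generator_const]
  rw [integral_const_mul, integral_gibbs]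
  have hf1 : ContDiff ℝ ∞ (deriv f) := (contDiff_infty_iff_deriv.1 hf).2
  have hf2 : ContDiff ℝ ∞ (deriv (deriv f)) := (contDiff_infty_iff_deriv.1 hf1).2
  have hE : Continuous fun x => Real.exp (-potential c l x) :=
    (contDiff_potential c l).continuous.neg.rexp
  have key : ∫ x, Real.exp (-potential c l x) *
      (deriv (deriv f) x - force c l x * deriv f x) = 0 := by
    refine integral_eq_zero_of_hasDerivAt_of_integrable
      (f := fun x => Real.exp (-potential c l x) * deriv f x) (fun x => ?_) ?_ ?_
    · have h1 := (hasDerivAt_potential c l x).fun_neg.exp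
      have h2 := ((contDiff_infty_iff_deriv.1 hf1).1 x).hasDerivAt
      refine (h1.fun_mul h2).congr_deriv ?_
      ring
    · refine Continuous.integrable_of_hasCompactSupport
        (hE.mul (hf2.continuous.sub ((contDiff_force c l).continuous.mul hf1.continuous))) ?_
      exact HasCompactSupport.mul_left (hcs.deriv.deriv.sub (HasCompactSupport.mul_left hcs.deriv))
    · exact Continuous.integrable_of_hasCompactSupport (hE.mul hf1.continuous)
        (HasCompactSupport.mul_left hcs.deriv)
  rw [key]; simp

/-! ### Uniqueness of the stationary law -/

/-- The pairing `∫ (u' - V' u) dν` for the potential `V = potential c l`. -/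
def steinPairing (c : ℝ) (l : ℕ) (ν : Measure ℝ) (u : ℝ → ℝ) : ℝ :=
  ∫ x, (deriv u x - force c l x * u x) ∂ν

lemma steinPairing_integrable (c : ℝ) (l : ℕ) (ν : Measure ℝ) [IsFiniteMeasure ν] {u : ℝ → ℝ}
    (hu : ContDiff ℝ ∞ u) (hcu : HasCompactSupport u) :
    Integrable (fun x => deriv u x - force c l x * u x) ν :=
  Continuous.integrable_of_hasCompactSupport
    ((contDiff_infty_iff_deriv.1 hu).2.continuous.sub
      ((contDiff_force c l).continuous.mul hu.continuous))
    (hcu.deriv.sub (HasCompactSupport.mul_left hcu))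

/-- Stationarity kills the pairing on derivatives of test functions, that is, on test functions of
mean zero; what remains can depend only on the Lebesgue integral. -/
lemma steinPairing_eq_of_integral_eq {σ c : ℝ} (hσ : σ ≠ 0) {l : ℕ} {ν : Measure ℝ}
    (hν : IsStationaryLaw (fun _ => 2 * σ) (fun x => -σ * force c l x) ν) {u v : ℝ → ℝ}
    (hu : ContDiff ℝ ∞ u) (hcu : HasCompactSupport u) (hv : ContDiff ℝ ∞ v)
    (hcv : HasCompactSupport v) (h : ∫ x, u x = ∫ x, v x) :
    steinPairing c l ν u = steinPairing c l ν v := by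
  have := hν.1
  have hi : ∫ x, (u x - v x) = 0 := by
    rw [integral_sub (hu.continuous.integrable_of_hasCompactSupport hcu)
      (hv.continuous.integrable_of_hasCompactSupport hcv), h, sub_self]
  obtain ⟨f, hf, hcf, hd⟩ := exists_compactSupport_primitive (hu.sub hv) (hcu.sub hcv) hi
  have h0 := hν.2 f hf hcf
  simp only [generator_const, hd] at h0
  rw [integral_const_mul, mul_eq_zero, or_iff_right hσ] at h0
  rw [← sub_eq_zero, steinPairing, steinPairing,
    ← integral_sub (steinPairing_integrable c l ν hu hcu) (steinPairing_integrable c l ν hv hcv),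
    ← h0]
  refine integral_congr_ae (ae_of_all _ fun x => ?_)
  have hdx : deriv (fun x => u x - v x) x = deriv u x - deriv v x :=
    deriv_fun_sub ((contDiff_infty_iff_deriv.1 hu).1 x) ((contDiff_infty_iff_deriv.1 hv).1 x)
  simp only [hdx]
  ring

lemma nonpos_of_forall_le_div {T B : ℝ} (h : ∀ R : ℝ, 1 ≤ R → T ≤ B / R) : T ≤ 0 := by
  have ht : Tendsto (fun R : ℝ => B / R) atTop (𝓝 0) := tendsto_const_nhds.div_atTop tendsto_id
  exact ge_of_tendsto ht ((eventually_ge_atTop 1).mono h)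

lemma force_nonneg {c : ℝ} (hc : 0 ≤ c) (l : ℕ) {x : ℝ} (hx : 0 ≤ x) : 0 ≤ force c l x := by
  unfold force; positivity

lemma force_neg (c : ℝ) (l : ℕ) (x : ℝ) : force c l (-x) = -force c l x := by
  simp only [force]
  rw [Odd.neg_pow ⟨l, rfl⟩]; ring

/-- Pairing with a nonnegative bump that is spread out far away on one side. -/
lemma steinPairing_bump {σ c : ℝ} (hσ : σ ≠ 0) (hc : 0 ≤ c) {l : ℕ} {ν : Measure ℝ}
    (hν : IsStationaryLaw (fun _ => 2 * σ) (fun x => -σ * force c l x) ν) {w : ℝ → ℝ}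
    (hw : ContDiff ℝ ∞ w) (hcw : HasCompactSupport w) (h0 : ∀ x, 0 ≤ w x)
    (hneg : ∀ x, x ≤ 0 → w x = 0) : steinPairing c l ν w = 0 := by
  have := hν.1
  have hw' : Continuous (deriv w) := (contDiff_infty_iff_deriv.1 hw).2.continuous
  obtain ⟨B, hB⟩ := hw'.bounded_above_of_compact_support hcw.deriv
  have hB0 : 0 ≤ B := (norm_nonneg _).trans (hB 0)
  -- Dilation by `s = ± 1 / R` preserves the integral, hence the pairing, while the derivative is of
  -- order `R ^ (-2)`, in particular at most `B / R`. The force term has no such bound, but it has a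
  -- sign once the bump lies on one side of the origin: the right side bounds the pairing above, the
  -- left side below.
  have hscale : ∀ s : ℝ, s ≠ 0 → ContDiff ℝ ∞ (fun x => |s| * w (s * x)) ∧
      HasCompactSupport (fun x => |s| * w (s * x)) ∧
      ∫ x, |s| * w (s * x) = ∫ x, w x ∧
      ∀ x, deriv (fun x => |s| * w (s * x)) x = |s| * (s * deriv w (s * x)) := by
    intro s hs
    refine ⟨by fun_prop, ?_, ?_, fun x => ?_⟩
    · exact HasCompactSupport.mul_left
        (hcw.comp_homeomorph (Homeomorph.mulLeft₀ s hs))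
    · rw [integral_const_mul, Measure.integral_comp_mul_left, smul_eq_mul, ← mul_assoc, abs_inv,
        mul_inv_cancel₀ (abs_ne_zero.2 hs), one_mul]
    · have h1 : HasDerivAt (fun x => w (s * x)) (deriv w (s * x) * s) x := by
        have h2 : HasDerivAt (fun x : ℝ => s * x) s x := by
          simpa using (hasDerivAt_id x).const_mul s
        exact ((contDiff_infty_iff_deriv.1 hw).1 (s * x)).hasDerivAt.comp x h2
      rw [(h1.const_mul |s|).deriv]; ring
  have hdb : ∀ s : ℝ, |s| ≤ 1 → ∀ x, |(|s| * (s * deriv w (s * x)))| ≤ B * |s| := by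
    intro s hs x
    rw [abs_mul, abs_abs, abs_mul]
    have h1 := hB (s * x)
    rw [Real.norm_eq_abs] at h1
    have h2 : |s| * |deriv w (s * x)| ≤ 1 * B :=
      mul_le_mul hs h1 (abs_nonneg _) zero_le_one
    nlinarith [abs_nonneg s]
  apply le_antisymm
  · refine nonpos_of_forall_le_div (B := B) fun R hR => ?_
    have hs : R⁻¹ ≠ 0 := by positivity
    have hs0 : 0 < R⁻¹ := by positivity
    obtain ⟨h1, h2, h3, h4⟩ := hscale _ hs
    rw [← steinPairing_eq_of_integral_eq hσ hν h1 h2 hw hcw h3, steinPairing]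
    have : B / R = ∫ _, B / R ∂ν := by simp
    rw [this]
    refine integral_mono (steinPairing_integrable c l ν h1 h2) (integrable_const _) fun x => ?_
    simp only [h4]
    have h5 := (le_abs_self _).trans
      (hdb R⁻¹ (by rw [abs_of_pos hs0]; exact inv_le_one_of_one_le₀ hR) x)
    rw [abs_of_pos hs0] at h5 ⊢
    have h6 : 0 ≤ force c l x * (R⁻¹ * w (R⁻¹ * x)) := by
      rcases le_total x 0 with hx | hx
      · rw [hneg _ (mul_nonpos_of_nonneg_of_nonpos hs0.le hx)]; simp
      · exact mul_nonneg (force_nonneg hc l hx) (mul_nonneg hs0.le (h0 _))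
    rw [div_eq_mul_inv]
    linarith
  · rw [← neg_nonpos]
    refine nonpos_of_forall_le_div (B := B) fun R hR => ?_
    have hs0 : 0 < R⁻¹ := by positivity
    have hs : -R⁻¹ ≠ 0 := neg_ne_zero.2 hs0.ne'
    obtain ⟨h1, h2, h3, h4⟩ := hscale _ hs
    rw [← steinPairing_eq_of_integral_eq hσ hν h1 h2 hw hcw h3, steinPairing, ← integral_neg]
    have : B / R = ∫ _, B / R ∂ν := by simp
    rw [this]
    refine integral_mono (steinPairing_integrable c l ν h1 h2).neg (integrable_const _) fun x => ?_
    simp only [h4]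
    have h5 := (neg_le_abs _).trans
      (hdb (-R⁻¹) (by rw [abs_neg, abs_of_pos hs0]; exact inv_le_one_of_one_le₀ hR) x)
    rw [abs_neg, abs_of_pos hs0] at h5 ⊢
    have h6 : force c l x * (R⁻¹ * w (-R⁻¹ * x)) ≤ 0 := by
      rcases le_total x 0 with hx | hx
      · have h7 : force c l x ≤ 0 := by
          have := force_nonneg hc l (neg_nonneg.2 hx)
          rw [force_neg] at this
          linarith
        exact mul_nonpos_of_nonpos_of_nonneg h7 (mul_nonneg hs0.le (h0 _))
      · rw [hneg _ (by nlinarith)]; simp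
    rw [div_eq_mul_inv]
    linarith

/-- A smooth bump of integral one supported in `[1, 3]`. -/
lemma exists_bump : ∃ w : ℝ → ℝ, ContDiff ℝ ∞ w ∧ HasCompactSupport w ∧ (∀ x, 0 ≤ w x) ∧
    (∀ x, x ≤ 0 → w x = 0) ∧ ∫ x, w x = 1 := by
  let b : ContDiffBump (2 : ℝ) := ⟨1 / 2, 1, by norm_num, by norm_num⟩
  refine ⟨b.normed volume, b.contDiff_normed, b.hasCompactSupport_normed, b.nonneg_normed,
    fun x hx => ?_, b.integral_normed⟩
  rw [← Function.notMem_support, b.support_normed_eq, Metric.mem_ball, Real.dist_eq, not_lt]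
  have : |x - 2| = 2 - x := by rw [abs_of_nonpos (by linarith)]; ring
  rw [this]
  change (1 : ℝ) ≤ 2 - x
  linarith

/-- Compare `u` with the multiple of a one-sided bump that has the same integral. -/
lemma steinPairing_eq_zero {σ c : ℝ} (hσ : σ ≠ 0) (hc : 0 ≤ c) {l : ℕ} {ν : Measure ℝ}
    (hν : IsStationaryLaw (fun _ => 2 * σ) (fun x => -σ * force c l x) ν) {u : ℝ → ℝ}
    (hu : ContDiff ℝ ∞ u) (hcu : HasCompactSupport u) : steinPairing c l ν u = 0 := by
  obtain ⟨w, hw, hcw, h0, hneg, h1⟩ := exists_bump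
  have h := steinPairing_eq_of_integral_eq hσ hν hu hcu
    (v := fun x => (∫ y, u y) * w x) (by fun_prop) (HasCompactSupport.mul_left hcw)
    (by rw [integral_const_mul, h1, mul_one])
  have h2 := steinPairing_bump hσ hc hν hw hcw h0 hneg
  have hd : ∀ x, deriv (fun x => (∫ y, u y) * w x) x = (∫ y, u y) * deriv w x := fun x =>
    deriv_const_mul _ ((contDiff_infty_iff_deriv.1 hw).1 x)
  rw [h]
  have h3 : steinPairing c l ν (fun x => (∫ y, u y) * w x)
      = (∫ y, u y) * steinPairing c l ν w := by
    rw [steinPairing, steinPairing, ← integral_const_mul]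
    refine integral_congr_ae (ae_of_all _ fun x => ?_)
    simp only [hd]
    ring
  rw [h3, h2, mul_zero]

/-- The substitution `u = ψ exp V` turns `u' - V' u` into `ψ' exp V`. So the measure with density
`exp V` against `ν` annihilates test functions of mean zero, and must be a multiple of Lebesgue
measure. -/
lemma integral_eq_const_mul_integral {σ c : ℝ} (hσ : σ ≠ 0) (hc : 0 ≤ c) {l : ℕ} {ν : Measure ℝ}
    (hν : IsStationaryLaw (fun _ => 2 * σ) (fun x => -σ * force c l x) ν) :
    ∃ κ : ℝ, ∀ h : ℝ → ℝ, ContDiff ℝ ∞ h → HasCompactSupport h →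
      ∫ x, h x ∂ν = κ * ∫ x, Real.exp (-potential c l x) * h x := by
  have := hν.1
  have hV := contDiff_potential c l
  have hzero : ∀ h : ℝ → ℝ, ContDiff ℝ ∞ h → HasCompactSupport h → ∫ x, h x = 0 →
      ∫ x, h x * Real.exp (potential c l x) ∂ν = 0 := by
    intro h hh hch hi
    obtain ⟨ψ, hψ, hcψ, hd⟩ := exists_compactSupport_primitive hh hch hi
    have hT := steinPairing_eq_zero hσ hc hν (u := fun x => ψ x * Real.exp (potential c l x))
      (by fun_prop) (HasCompactSupport.mul_right hcψ)
    rw [← hT, steinPairing]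
    refine integral_congr_ae (ae_of_all _ fun x => ?_)
    have h1 := ((contDiff_infty_iff_deriv.1 hψ).1 x).hasDerivAt.fun_mul
      (hasDerivAt_potential c l x).exp
    rw [hd] at h1
    simp only [h1.deriv]
    ring
  obtain ⟨w, hw, hcw, -, -, h1⟩ := exists_bump
  refine ⟨∫ x, w x * Real.exp (potential c l x) ∂ν, fun h hh hch => ?_⟩
  set F := ∫ x, Real.exp (-potential c l x) * h x with hF
  have hu : ContDiff ℝ ∞ fun x => Real.exp (-potential c l x) * h x := by fun_prop
  have hcu : HasCompactSupport fun x => Real.exp (-potential c l x) * h x :=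
    HasCompactSupport.mul_left hch
  have hFw : ContDiff ℝ ∞ fun x => F * w x := by fun_prop
  have hcF : HasCompactSupport fun x => F * w x := HasCompactSupport.mul_left hcw
  -- Subtracting `F w` makes the test function mean zero; the constant `κ` is the value found on the
  -- reference bump `w`.
  have h2 := hzero (fun x => Real.exp (-potential c l x) * h x - F * w x) (hu.sub hFw)
    (hcu.sub hcF) (by
      rw [integral_sub (hu.continuous.integrable_of_hasCompactSupport hcu)
        (hFw.continuous.integrable_of_hasCompactSupport hcF), integral_const_mul, h1, ← hF]
      ring)
  have h3 : ∀ x, (Real.exp (-potential c l x) * h x - F * w x) * Real.exp (potential c l x)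
      = h x - F * (w x * Real.exp (potential c l x)) := by
    intro x
    have : Real.exp (-potential c l x) * Real.exp (potential c l x) = 1 := by
      rw [← Real.exp_add]; simp
    linear_combination h x * this
  simp only [h3] at h2
  rw [integral_sub (hh.continuous.integrable_of_hasCompactSupport hch), integral_const_mul,
    sub_eq_zero] at h2
  · rw [h2]; ring
  · have : Continuous fun x => F * (w x * Real.exp (potential c l x)) :=
      continuous_const.mul (hw.continuous.mul hV.continuous.rexp)
    exact this.integrable_of_hasCompactSupport
      (HasCompactSupport.mul_left (HasCompactSupport.mul_right hcw))

/-- If the integrals of smooth functions of compact support against two finite measures are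
proportional, so are the measures of balls. -/
lemma measureReal_ball_eq {μ ν : Measure ℝ} [IsFiniteMeasure μ] [IsFiniteMeasure ν] {κ : ℝ}
    (h : ∀ f : ℝ → ℝ, ContDiff ℝ ∞ f → HasCompactSupport f → ∫ x, f x ∂ν = κ * ∫ x, f x ∂μ)
    (a : ℝ) {r : ℝ} (hr : 0 < r) :
    ν.real (Metric.ball a r) = κ * μ.real (Metric.ball a r) := by
  have hpos : ∀ k : ℕ, 0 < r / (k + 2) := fun k => by positivity
  have hlt : ∀ k : ℕ, r / (k + 2) < r := fun k =>
    div_lt_self hr (by linarith [(Nat.cast_nonneg k : (0 : ℝ) ≤ k)])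
  -- These bumps are one on a ball of radius `r - r / (k + 2)` and vanish off the open ball, so they
  -- converge pointwise to its indicator.
  let b : ℕ → ContDiffBump a := fun k =>
    ⟨r - r / (k + 2), r, by linarith [hlt k], by linarith [hpos k]⟩
  have hlim : ∀ ρ : Measure ℝ, IsFiniteMeasure ρ →
      Tendsto (fun k => ∫ x, b k x ∂ρ) atTop (𝓝 (ρ.real (Metric.ball a r))) := by
    intro ρ hρ
    have hball : ρ.real (Metric.ball a r) = ∫ x, (Metric.ball a r).indicator 1 x ∂ρ :=
      (integral_indicator_one measurableSet_ball).symm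
    rw [hball]
    refine tendsto_integral_of_dominated_convergence (fun _ => 1)
      (fun k => (b k).continuous.aestronglyMeasurable) (integrable_const _)
      (fun k => ae_of_all _ fun x => ?_) (ae_of_all _ fun x => ?_)
    · rw [Real.norm_eq_abs, abs_of_nonneg (b k).nonneg]
      exact (b k).le_one
    · by_cases hx : x ∈ Metric.ball a r
      · rw [indicator_of_mem hx]
        have hk : Tendsto (fun k : ℕ => r - r / ((k : ℝ) + 2)) atTop (𝓝 (r - 0)) :=
          tendsto_const_nhds.sub (tendsto_const_nhds.div_atTop
            (tendsto_natCast_atTop_atTop.atTop_add tendsto_const_nhds))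
        rw [sub_zero] at hk
        refine tendsto_const_nhds.congr' ?_
        filter_upwards [hk.eventually (lt_mem_nhds (Metric.mem_ball.1 hx))] with k hk
        exact ((b k).one_of_mem_closedBall (Metric.mem_closedBall.2 hk.le)).symm
      · rw [indicator_of_notMem hx]
        refine tendsto_const_nhds.congr fun k => ?_
        exact ((b k).zero_of_le_dist (not_lt.1 hx)).symm
  refine tendsto_nhds_unique (hlim ν inferInstance) ?_
  refine ((hlim μ inferInstance).const_mul κ).congr fun k => ?_
  exact (h (b k) (b k).contDiff (b k).hasCompactSupport).symm

lemma eq_of_integral_smooth_proportional {μ ν : Measure ℝ} [IsProbabilityMeasure μ]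
    [IsProbabilityMeasure ν] {κ : ℝ}
    (h : ∀ f : ℝ → ℝ, ContDiff ℝ ∞ f → HasCompactSupport f → ∫ x, f x ∂ν = κ * ∫ x, f x ∂μ) :
    ν = μ := by
  have hball := measureReal_ball_eq h
  have hlim : ∀ ρ : Measure ℝ, IsProbabilityMeasure ρ →
      Tendsto (fun k : ℕ => ρ.real (Metric.ball 0 ((k : ℝ) + 1))) atTop (𝓝 1) := by
    intro ρ hρ
    have hmono : Monotone fun k : ℕ => Metric.ball (0 : ℝ) ((k : ℝ) + 1) := fun i j hij =>
      Metric.ball_subset_ball (by gcongr)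
    have hU : ⋃ k : ℕ, Metric.ball (0 : ℝ) ((k : ℝ) + 1) = univ := by
      refine eq_univ_of_forall fun x => mem_iUnion.2 ?_
      obtain ⟨k, hk⟩ := exists_nat_ge |x|
      exact ⟨k, by rw [mem_ball_zero_iff, Real.norm_eq_abs]; linarith⟩
    have := tendsto_measure_iUnion_atTop (μ := ρ) hmono
    rw [hU, measure_univ] at this
    exact (ENNReal.tendsto_toReal ENNReal.one_ne_top).comp this
  -- Balls exhausting the line force the proportionality constant to be the ratio of the total
  -- masses.
  have hκ : κ = 1 := by
    have h1 := ((hlim μ inferInstance).const_mul κ)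
    have h2 := hlim ν inferInstance
    have h3 := tendsto_nhds_unique h2 (h1.congr fun k => (hball 0 (by positivity)).symm)
    linarith
  subst hκ
  refine Real.measure_ext_Ioo_rat fun p q => ?_
  rcases le_or_gt (q : ℝ) p with hpq | hpq
  · simp [Ioo_eq_empty (not_lt.2 hpq)]
  · have h1 := hball (((p : ℝ) + q) / 2) (r := ((q : ℝ) - p) / 2) (by linarith)
    rw [one_mul, ← Real.Ioo_eq_ball, measureReal_eq_measureReal_iff] at h1
    exact h1

theorem isStationaryLaw_iff {σ c : ℝ} (hσ : σ ≠ 0) (hc : 0 < c) (l : ℕ) (ν : Measure ℝ) :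
    IsStationaryLaw (fun _ => 2 * σ) (fun x => -σ * force c l x) ν ↔ ν = gibbs c l := by
  refine ⟨fun hν => ?_, fun h => h ▸ isStationaryLaw_gibbs σ hc l⟩
  have := hν.1
  have := isProbabilityMeasure_gibbs hc l
  obtain ⟨κ, hκ⟩ := integral_eq_const_mul_integral hσ hc.le hν
  refine eq_of_integral_smooth_proportional (κ := κ * partition c l) fun f hf hcf => ?_
  rw [hκ f hf hcf, integral_gibbs, mul_assoc, mul_div_cancel₀ _ (partition_pos hc l).ne']

/-! ### The Stein equation -/

/-- Superadditivity of an even power on each half-line. It is what bounds the Stein solution: `exp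
(V x - V y) ≤ exp (-V (y - x))` for `y` farther out than `x` on the same side. -/
lemma potential_add_le {c : ℝ} (hc : 0 ≤ c) (l : ℕ) {x y : ℝ}
    (h : 0 ≤ x ∧ x ≤ y ∨ x ≤ 0 ∧ y ≤ x) :
    potential c l x + potential c l (y - x) ≤ potential c l y := by
  have hev : Even (2 * l + 2) := ⟨l + 1, by ring⟩
  have key : ∀ a b : ℝ, 0 ≤ a → 0 ≤ b →
      a ^ (2 * l + 2) + b ^ (2 * l + 2) ≤ (a + b) ^ (2 * l + 2) := fun a b ha hb =>
    pow_add_pow_le ha hb (by omega)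
  simp only [potential, ← mul_add]
  refine mul_le_mul_of_nonneg_left ?_ hc
  rcases h with ⟨h1, h2⟩ | ⟨h1, h2⟩
  · simpa using key x (y - x) h1 (by linarith)
  · have := key (-x) (-(y - x)) (by linarith) (by linarith)
    rw [hev.neg_pow, hev.neg_pow, ← neg_add, hev.neg_pow] at this
    simpa using this

theorem exists_stein_solution {c : ℝ} (hc : 0 < c) (l : ℕ) {φ : ℝ → ℝ} (hφ : Continuous φ) {M : ℝ}
    (hM : ∀ x, |φ x| ≤ M) :
    ∃ g : ℝ → ℝ,
      (∀ x, HasDerivAt g (force c l x * g x + (φ x - ∫ y, φ y ∂(gibbs c l))) x) ∧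
      ∀ x, |g x| ≤ 2 * M * partition c l := by
  have := isProbabilityMeasure_gibbs hc l
  set m := ∫ y, φ y ∂(gibbs c l) with hm
  have hmM : |m| ≤ M := by
    have := norm_integral_le_of_norm_le_const (μ := gibbs c l) (f := φ) (C := M)
      (ae_of_all _ fun x => hM x)
    simpa using this
  have hb : ∀ x, |φ x - m| ≤ 2 * M := fun x => by
    have := abs_sub (φ x) m
    linarith [hM x]
  have hZ := integrable_exp_neg_potential hc l
  have hVc := (contDiff_potential c l).continuous
  have hψc : Continuous fun x => Real.exp (-potential c l x) * (φ x - m) :=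
    hVc.neg.rexp.mul (hφ.sub continuous_const)
  have hψi : Integrable fun x => Real.exp (-potential c l x) * (φ x - m) :=
    hZ.mul_bdd (c := 2 * M) (hφ.sub continuous_const).aestronglyMeasurable (ae_of_all _ hb)
  -- Centering lets the solution be written through either tail; for each `x` the tail pointing away
  -- from the origin is used.
  have hψ0 : ∫ x, Real.exp (-potential c l x) * (φ x - m) = 0 := by
    have h1 : Integrable fun x => Real.exp (-potential c l x) * φ x :=
      hZ.mul_bdd (c := M) hφ.aestronglyMeasurable (ae_of_all _ hM)
    simp only [mul_sub]
    rw [integral_sub h1 (hZ.mul_const m), integral_mul_const, hm, integral_gibbs, ← partition,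
      mul_div_cancel₀ _ (partition_pos hc l).ne', sub_self]
  -- After superadditivity the integrand is a translate of `exp (-V)`, whose integral over the whole
  -- line is the partition function independently of `x`.
  have hset : ∀ (s : Set ℝ) (x : ℝ), MeasurableSet s →
      (∀ y ∈ s, 0 ≤ x ∧ x ≤ y ∨ x ≤ 0 ∧ y ≤ x) →
      |Real.exp (potential c l x) * ∫ y in s, Real.exp (-potential c l y) * (φ y - m)|
        ≤ 2 * M * partition c l := by
    intro s x hs hsx
    have hint : Integrable fun y => 2 * M * Real.exp (-potential c l (y - x)) :=
      (hZ.comp_sub_right x).const_mul _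
    have hM0 : 0 ≤ M := (abs_nonneg _).trans (hM 0)
    rw [← integral_const_mul, ← Real.norm_eq_abs]
    refine (norm_integral_le_of_norm_le hint.integrableOn ?_).trans ?_
    · refine (ae_restrict_iff' hs).2 (ae_of_all _ fun y hy => ?_)
      rw [Real.norm_eq_abs, ← mul_assoc, ← Real.exp_add, abs_mul, abs_of_pos (Real.exp_pos _),
        mul_comm]
      refine mul_le_mul (hb y) (Real.exp_le_exp.2 ?_) (Real.exp_pos _).le (by linarith)
      linarith [potential_add_le hc.le l (hsx y hy)]
    · refine (setIntegral_le_integral hint (ae_of_all _ fun y => ?_)).trans ?_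
      · have := Real.exp_pos (-potential c l (y - x))
        simp only [Pi.zero_apply]
        positivity
      · rw [integral_const_mul, integral_sub_right_eq_self (fun y => Real.exp (-potential c l y)) x,
          partition]
  refine ⟨fun x => Real.exp (potential c l x) *
    ∫ y in Iic x, Real.exp (-potential c l y) * (φ y - m), fun x => ?_, fun x => ?_⟩
  · refine ((hasDerivAt_potential c l x).exp.fun_mul
      (hasDerivAt_integral_Iic hψc hψi x)).congr_deriv ?_
    have : Real.exp (potential c l x) * Real.exp (-potential c l x) = 1 := by
      rw [← Real.exp_add]; simp
    linear_combination (φ x - m) * this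
  · rcases le_total x 0 with hx | hx
    · exact hset (Iic x) x measurableSet_Iic fun y hy => Or.inr ⟨hx, hy⟩
    · have h1 : ∫ y in Iic x, Real.exp (-potential c l y) * (φ y - m)
          = -∫ y in Ioi x, Real.exp (-potential c l y) * (φ y - m) := by
        have := intervalIntegral.integral_Iic_add_Ioi (b := x) hψi.integrableOn hψi.integrableOn
        rw [hψ0] at this
        linarith
      simp only [h1]
      rw [mul_neg, abs_neg]
      exact hset (Ioi x) x measurableSet_Ioi fun y hy => Or.inl ⟨hx, le_of_lt hy⟩

/-! ### Comparison of a discrete law with the Gibbs measure -/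

/-- Polynomial growth weight. -/
def growth (l : ℕ) (x : ℝ) : ℝ := (1 + |x|) ^ (2 * l + 1)

lemma one_le_growth (l : ℕ) (x : ℝ) : 1 ≤ growth l x :=
  one_le_pow₀ (by linarith [abs_nonneg x])

lemma growth_le {l : ℕ} {x y : ℝ} (h : |y - x| ≤ 1) :
    growth l y ≤ 2 ^ (2 * l + 1) * growth l x := by
  rw [growth, growth, ← mul_pow]
  refine pow_le_pow_left₀ (by positivity) ?_ _
  have := abs_sub_abs_le_abs_sub y x
  linarith [abs_nonneg x]

lemma abs_force_le {c : ℝ} (hc : 0 ≤ c) (l : ℕ) (x : ℝ) :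
    |force c l x| ≤ c * (2 * l + 2) * growth l x := by
  rw [force, growth, abs_mul, abs_pow, abs_of_nonneg (by positivity : 0 ≤ c * (2 * (l : ℝ) + 2))]
  gcongr
  linarith

lemma abs_sub_le_of_hasDerivAt_Icc {f f' : ℝ → ℝ} {a b C : ℝ}
    (hf : ∀ y ∈ Icc a b, HasDerivAt f (f' y) y) (hC : ∀ y ∈ Icc a b, |f' y| ≤ C) {x y : ℝ}
    (hx : x ∈ Icc a b) (hy : y ∈ Icc a b) : |f y - f x| ≤ C * |y - x| :=
  (convex_Icc a b).norm_image_sub_le_of_norm_hasDerivWithin_le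
    (fun z hz => (hf z hz).hasDerivWithinAt) hC hx hy

lemma hasDerivAt_force (c : ℝ) (l : ℕ) (x : ℝ) :
    HasDerivAt (force c l) (c * (2 * l + 2) * ((2 * l + 1) * x ^ (2 * l))) x := by
  have h := (hasDerivAt_pow (2 * l + 1) x).const_mul (c * (2 * (l : ℝ) + 2))
  refine h.congr_deriv ?_
  push_cast
  simp

/-- Only `g` and `ψ` are bounded globally; `g'` is replaced by `V' g + ψ`, which costs a factor of
polynomial growth per derivative. Two such factors appear, hence the squared weight, to be absorbed
by moments. -/
lemma stein_difference_bound {c : ℝ} (hc : 0 ≤ c) (l : ℕ) {L : ℝ} (hL : 0 ≤ L) :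
    ∃ C : ℝ, 0 ≤ C ∧ ∀ (g ψ : ℝ → ℝ) (N A B κ h ε x : ℝ),
      (∀ y, HasDerivAt g (force c l y * g y + ψ y) y) → (∀ y, |g y| ≤ N) → (∀ y, |ψ y| ≤ N) →
      (∀ y z, |ψ y - ψ z| ≤ N * |y - z|) → 0 < κ → 0 < h → h ≤ 1 → h ≤ ε →
      |A - B + 2 * κ * h * force c l x| ≤ 2 * κ * h * (L * ε * growth l x ^ 2) →
      |A + B - 2 * κ| ≤ 2 * κ * (L * ε * growth l x) →
      |(A * g (x + h) - B * g (x - h)) - 2 * κ * h * ψ x|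
        ≤ 2 * κ * h * (C * N * ε * growth l x ^ 2) := by
  set F := c * (2 * (l : ℝ) + 2) with hF
  set D : ℝ := 2 ^ (2 * l + 1) with hD
  have hF0 : 0 ≤ F := by positivity
  have hD0 : 0 ≤ D := by positivity
  set J : ℝ := 2 * l + 1 with hJ
  have hJ0 : 0 ≤ J := by positivity
  set E := F * D * (F * D + 1) + F * J * D + 1 with hE
  have hE0 : 0 ≤ E := by positivity
  refine ⟨F * (F * D + 1) + L + E + L * (F * D + 1), by positivity, ?_⟩
  intro g ψ N A B κ h ε x hg hgN hψN hψL hκ hh hh1 hhε hAB hAB'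
  have hN0 : 0 ≤ N := (abs_nonneg _).trans (hgN 0)
  set W := growth l x with hW
  have hW1 : 1 ≤ W := one_le_growth l x
  have hW0 : 0 ≤ W := by linarith
  have hnear : ∀ y ∈ Icc (x - h) (x + h), |y - x| ≤ h := fun y hy => by
    rw [abs_le]; constructor <;> linarith [hy.1, hy.2]
  have hfor : ∀ y ∈ Icc (x - h) (x + h), |force c l y| ≤ F * (D * W) := fun y hy =>
    (abs_force_le hc l y).trans
      (mul_le_mul_of_nonneg_left (growth_le ((hnear y hy).trans hh1)) hF0)
  have hg' : ∀ y ∈ Icc (x - h) (x + h),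
      |force c l y * g y + ψ y| ≤ (F * D + 1) * W * N := fun y hy => by
    have h1 : |force c l y * g y| ≤ F * (D * W) * N := by
      rw [abs_mul]
      exact mul_le_mul (hfor y hy) (hgN y) (abs_nonneg _) (by positivity)
    have h2 := abs_add_le (force c l y * g y) (ψ y)
    have h3 : N ≤ W * N := le_mul_of_one_le_left hN0 hW1
    linarith [hψN y]
  have hx : x ∈ Icc (x - h) (x + h) := ⟨by linarith, by linarith⟩
  have hxp : x + h ∈ Icc (x - h) (x + h) := ⟨by linarith, le_rfl⟩
  have hxm : x - h ∈ Icc (x - h) (x + h) := ⟨le_rfl, by linarith⟩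
  have hgd : ∀ y ∈ Icc (x - h) (x + h), |g y - g x| ≤ (F * D + 1) * W * N * h := fun y hy =>
    (abs_sub_le_of_hasDerivAt_Icc (fun z _ => hg z) hg' hx hy).trans
      (mul_le_mul_of_nonneg_left (hnear y hy) (by positivity))
  have hfd : ∀ y ∈ Icc (x - h) (x + h), |force c l y - force c l x| ≤ F * (J * (D * W)) * h := by
    intro y hy
    refine (abs_sub_le_of_hasDerivAt_Icc (C := F * (J * (D * W)))
      (fun z _ => hasDerivAt_force c l z) (fun z hz => ?_) hx hy).trans
      (mul_le_mul_of_nonneg_left (hnear y hy) (by positivity))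
    change |F * (J * z ^ (2 * l))| ≤ _
    rw [abs_mul F, abs_mul J, abs_of_nonneg hF0, abs_of_nonneg hJ0, abs_pow]
    refine mul_le_mul_of_nonneg_left (mul_le_mul_of_nonneg_left ?_ hJ0) hF0
    refine le_trans ?_ (growth_le ((hnear z hz).trans hh1))
    rw [growth]
    have h0 : |z| ≤ 1 + |z| := by linarith
    refine (pow_le_pow_left₀ (abs_nonneg z) h0 _).trans ?_
    exact pow_le_pow_right₀ (by linarith [abs_nonneg z]) (by omega)
  -- `g'` is Lipschitz near `x` because `V'`, `g` and `ψ` are; no second derivative of `g` is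
  -- needed.
  have hg'd : ∀ y ∈ Icc (x - h) (x + h),
      |(force c l y * g y + ψ y) - (force c l x * g x + ψ x)| ≤ E * N * W ^ 2 * h := by
    intro y hy
    have e : (force c l y * g y + ψ y) - (force c l x * g x + ψ x)
        = force c l y * (g y - g x) + (force c l y - force c l x) * g x + (ψ y - ψ x) := by ring
    have h1 : |force c l y * (g y - g x)| ≤ F * (D * W) * ((F * D + 1) * W * N * h) := by
      rw [abs_mul]
      exact mul_le_mul (hfor y hy) (hgd y hy) (abs_nonneg _) (by positivity)
    have h2 : |(force c l y - force c l x) * g x| ≤ F * (J * (D * W)) * h * N := by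
      rw [abs_mul]
      exact mul_le_mul (hfd y hy) (hgN x) (abs_nonneg _) (by positivity)
    have h3 : |ψ y - ψ x| ≤ N * h :=
      (hψL y x).trans (mul_le_mul_of_nonneg_left (hnear y hy) hN0)
    have h4 : W ≤ W ^ 2 := by nlinarith
    have h5 : 1 ≤ W ^ 2 := by nlinarith
    have h6 : F * (J * (D * W)) * h * N ≤ F * J * D * W ^ 2 * h * N := by
      have : 0 ≤ F * J * D * h * N := by positivity
      nlinarith
    have h7 : N * h ≤ W ^ 2 * (N * h) := le_mul_of_one_le_left (by positivity) h5
    rw [e]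
    refine (abs_add_le _ _).trans ((add_le_add (abs_add_le _ _) le_rfl).trans ?_)
    rw [hE]
    linarith
  have hdiff : |g (x + h) - g (x - h) - 2 * h * (force c l x * g x + ψ x)|
      ≤ E * N * W ^ 2 * h * (2 * h) := by
    have := abs_sub_le_of_hasDerivAt_Icc (f := fun y => g y - (force c l x * g x + ψ x) * y)
      (f' := fun y => (force c l y * g y + ψ y) - (force c l x * g x + ψ x))
      (a := x - h) (b := x + h)
      (fun z _ => ((hg z).fun_sub ((hasDerivAt_id z).const_mul _)).congr_deriv (by simp))
      hg'd hxm hxp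
    have e : |x + h - (x - h)| = 2 * h := by
      rw [abs_of_nonneg (by linarith)]; ring
    rw [e] at this
    refine le_trans (le_of_eq ?_) this
    congr 1
    ring
  have hDg : |g (x + h) - g (x - h)| ≤ (F * D + 1) * W * N * (2 * h) := by
    have := abs_sub_le_of_hasDerivAt_Icc (fun z _ => hg z) hg' hxm hxp
    have e : |x + h - (x - h)| = 2 * h := by
      rw [abs_of_nonneg (by linarith)]; ring
    rwa [e] at this
  set gp := g (x + h)
  set gm := g (x - h)
  have hfx : |force c l x| ≤ F * W := abs_force_le hc l x
  have e : (A * gp - B * gm) - 2 * κ * h * ψ x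
      = -(κ * h * force c l x * ((gp - g x) + (gm - g x)))
        + (A - B + 2 * κ * h * force c l x) * ((gp + gm) / 2)
        + κ * (gp - gm - 2 * h * (force c l x * g x + ψ x))
        + (A + B - 2 * κ) / 2 * (gp - gm) := by ring
  have b1 : |κ * h * force c l x * ((gp - g x) + (gm - g x))|
      ≤ κ * h * (F * W) * (2 * ((F * D + 1) * W * N * ε)) := by
    rw [abs_mul, abs_mul, abs_of_pos (by positivity : 0 < κ * h)]
    refine mul_le_mul (mul_le_mul_of_nonneg_left hfx (by positivity)) ?_ (abs_nonneg _)
      (by positivity)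
    have h1 := abs_add_le (gp - g x) (gm - g x)
    have h2 : (F * D + 1) * W * N * h ≤ (F * D + 1) * W * N * ε :=
      mul_le_mul_of_nonneg_left hhε (by positivity)
    linarith [hgd _ hxp, hgd _ hxm]
  have b2 : |(A - B + 2 * κ * h * force c l x) * ((gp + gm) / 2)|
      ≤ 2 * κ * h * (L * ε * W ^ 2) * N := by
    rw [abs_mul]
    refine mul_le_mul hAB ?_ (abs_nonneg _) ((abs_nonneg _).trans hAB)
    rw [abs_div, abs_two]
    have := abs_add_le gp gm
    linarith [hgN (x + h), hgN (x - h)]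
  have b3 : |κ * (gp - gm - 2 * h * (force c l x * g x + ψ x))|
      ≤ κ * (E * N * W ^ 2 * ε * (2 * h)) := by
    rw [abs_mul, abs_of_pos hκ]
    refine mul_le_mul_of_nonneg_left (hdiff.trans ?_) hκ.le
    gcongr
  have b4 : |(A + B - 2 * κ) / 2 * (gp - gm)|
      ≤ κ * (L * ε * W) * ((F * D + 1) * W * N * (2 * h)) := by
    have hε : 0 ≤ ε := hh.le.trans hhε
    rw [abs_mul, abs_div, abs_two]
    exact mul_le_mul (by linarith) hDg (abs_nonneg _) (by positivity)
  rw [e]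
  refine (abs_add_le _ _).trans ((add_le_add ((abs_add_le _ _).trans
    (add_le_add ((abs_add_le _ _).trans (add_le_add (abs_neg _).le le_rfl)) le_rfl)) le_rfl).trans ?_)
  linarith

theorem stein_comparison {c : ℝ} (hc : 0 < c) (l : ℕ) {L : ℝ} (hL : 0 ≤ L) (Q : ℝ) :
    ∃ C : ℝ, ∀ (n : ℕ) (p x A B : Fin (n + 1) → ℝ) (κ h ε : ℝ),
      (∀ k, 0 ≤ p k) → ∑ k, p k = 1 → 0 < κ → 0 < h → h ≤ 1 → h ≤ ε →
      (∀ k, |A k - B k + 2 * κ * h * force c l (x k)|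
        ≤ 2 * κ * h * (L * ε * growth l (x k) ^ 2)) →
      (∀ k, |A k + B k - 2 * κ| ≤ 2 * κ * (L * ε * growth l (x k))) →
      (∀ g : ℝ → ℝ, ∑ k, p k * (A k * g (x k + h) - B k * g (x k - h)) = 0) →
      ∑ k, p k * growth l (x k) ^ 2 ≤ Q →
      ∀ (φ : ℝ → ℝ) (M : ℝ) (K : ℝ≥0), (∀ y, |φ y| ≤ M) → LipschitzWith K φ →
        |∑ k, p k * φ (x k) - ∫ y, φ y ∂(gibbs c l)| ≤ C * (M + K) * ε := by
  obtain ⟨C, hC0, hC⟩ := stein_difference_bound hc.le l hL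
  refine ⟨C * (2 * partition c l + 2) * Q, ?_⟩
  intro n p x A B κ h ε hp hp1 hκ hh hh1 hhε hAB hAB' hid hQ φ M K hM hK
  have := isProbabilityMeasure_gibbs hc l
  have hM0 : 0 ≤ M := (abs_nonneg _).trans (hM 0)
  have hK0 : (0 : ℝ) ≤ K := K.2
  have hZ := partition_pos hc l
  obtain ⟨g, hg, hgM⟩ := exists_stein_solution hc l hK.continuous hM
  set m := ∫ y, φ y ∂(gibbs c l) with hm
  have hmM : |m| ≤ M := by
    have := norm_integral_le_of_norm_le_const (μ := gibbs c l) (f := φ) (C := M)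
      (ae_of_all _ fun x => hM x)
    simpa using this
  -- One constant dominating the three bounds needed: `2 M Z` for the solution (`Z` the partition
  -- function), `2 M` for the centered function, and `K` for its Lipschitz constant.
  set N := (2 * partition c l + 2) * (M + K) with hN
  have hN0 : 0 ≤ N := by positivity
  have hgN : ∀ y, |g y| ≤ N := fun y => (hgM y).trans (by rw [hN]; nlinarith [mul_nonneg hZ.le hK0])
  have hψN : ∀ y, |φ y - m| ≤ N := fun y => by
    have h1 := abs_sub (φ y) m
    have h2 := hM y
    have h3 : 2 * M ≤ N := by
      rw [hN]; nlinarith [mul_nonneg hZ.le hK0, mul_nonneg hZ.le hM0]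
    linarith
  have hψL : ∀ y z, |(φ y - m) - (φ z - m)| ≤ N * |y - z| := fun y z => by
    have h1 := hK.dist_le_mul y z
    rw [Real.dist_eq, Real.dist_eq] at h1
    rw [sub_sub_sub_cancel_right]
    refine h1.trans (mul_le_mul_of_nonneg_right ?_ (abs_nonneg _))
    rw [hN]; nlinarith [mul_nonneg hZ.le hK0, mul_nonneg hZ.le hM0]
  have hpt := fun k => hC g (fun y => φ y - m) N (A k) (B k) κ h ε (x k) hg hgN hψN hψL hκ hh hh1
    hhε (hAB k) (hAB' k)
  have hsum : ∑ k, p k * φ (x k) - m = ∑ k, p k * (φ (x k) - m) := by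
    simp only [mul_sub, Finset.sum_sub_distrib, ← Finset.sum_mul, hp1, one_mul]
  have hkh : 0 < 2 * κ * h := by positivity
  have hscaled : 2 * κ * h * |∑ k, p k * (φ (x k) - m)|
      ≤ 2 * κ * h * (C * N * ε * Q) := by
    have e : 2 * κ * h * |∑ k, p k * (φ (x k) - m)|
        = |∑ k, p k * ((A k * g (x k + h) - B k * g (x k - h)) - 2 * κ * h * (φ (x k) - m))| := by
      have : ∑ k, p k * ((A k * g (x k + h) - B k * g (x k - h)) - 2 * κ * h * (φ (x k) - m))
          = -(2 * κ * h * ∑ k, p k * (φ (x k) - m)) := by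
        simp only [mul_sub (p _) (A _ * _ - _), Finset.sum_sub_distrib, hid g, zero_sub,
          Finset.mul_sum]
        congr 1
        exact Finset.sum_congr rfl fun k _ => by ring
      rw [this, abs_neg, abs_mul, abs_of_pos hkh]
    rw [e]
    refine (Finset.abs_sum_le_sum_abs _ _).trans ?_
    have hε : 0 ≤ ε := hh.le.trans hhε
    calc ∑ k, |p k * ((A k * g (x k + h) - B k * g (x k - h)) - 2 * κ * h * (φ (x k) - m))|
        ≤ ∑ k, p k * (2 * κ * h * (C * N * ε * growth l (x k) ^ 2)) := by
          refine Finset.sum_le_sum fun k _ => ?_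
          rw [abs_mul, abs_of_nonneg (hp k)]
          exact mul_le_mul_of_nonneg_left (hpt k) (hp k)
      _ = 2 * κ * h * (C * N * ε * ∑ k, p k * growth l (x k) ^ 2) := by
          simp only [Finset.mul_sum]
          exact Finset.sum_congr rfl fun k _ => by ring
      _ ≤ 2 * κ * h * (C * N * ε * Q) := by gcongr
  rw [hsum]
  refine (le_of_mul_le_mul_left hscaled hkh).trans (le_of_eq ?_)
  rw [hN]; ring

/-! ### Birth–death chains -/

/-- Transition matrix of a birth–death chain with up-rates `a` and down-rates `b`. -/
def birthDeath (a b : ℕ → ℝ) (n : ℕ) : Matrix (Fin (n + 1)) (Fin (n + 1)) ℝ :=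
  fun i j =>
    if (j : ℕ) = i + 1 then a i
    else if (i : ℕ) = j + 1 then b i
    else if i = j then 1 - a i - b i
    else 0

/-- Extension of a vector by zero. -/
def extendZero {n : ℕ} (p : Fin (n + 1) → ℝ) (k : ℕ) : ℝ :=
  if h : k < n + 1 then p ⟨k, h⟩ else 0

lemma extendZero_val {n : ℕ} (p : Fin (n + 1) → ℝ) (k : Fin (n + 1)) :
    extendZero p k = p k := by
  simp only [extendZero]
  rw [dif_pos k.2]

lemma extendZero_of_lt {n : ℕ} (p : Fin (n + 1) → ℝ) {k : ℕ} (h : n < k) : extendZero p k = 0 := by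
  simp only [extendZero]
  rw [dif_neg (by omega)]

lemma vecMul_birthDeath (a b : ℕ → ℝ) {n : ℕ} (p : Fin (n + 1) → ℝ) (j : Fin (n + 1)) :
    (p ᵥ* birthDeath a b n) j
      = (if (j : ℕ) = 0 then 0 else extendZero p (j - 1) * a (j - 1))
        + extendZero p (j + 1) * b (j + 1) + p j * (1 - a j - b j) := by
  have hsplit : ∀ i : Fin (n + 1), p i * birthDeath a b n i j
      = (fun i : ℕ => (if (j : ℕ) = i + 1 then extendZero p i * a i else 0)
        + (if i = (j : ℕ) + 1 then extendZero p i * b i else 0)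
        + (if i = (j : ℕ) then extendZero p i * (1 - a i - b i) else 0)) i := by
    intro i
    simp only [birthDeath, extendZero_val, Fin.ext_iff]
    split_ifs <;> first | omega | ring
  rw [Matrix.vecMul, dotProduct, Finset.sum_congr rfl fun i _ => hsplit i,
    Fin.sum_univ_eq_sum_range (fun i : ℕ => (if (j : ℕ) = i + 1 then extendZero p i * a i else 0)
        + (if i = (j : ℕ) + 1 then extendZero p i * b i else 0)
        + (if i = (j : ℕ) then extendZero p i * (1 - a i - b i) else 0)),
    Finset.sum_add_distrib, Finset.sum_add_distrib]
  congr 1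
  · congr 1
    · have hj := j.2
      rcases Nat.eq_zero_or_eq_succ_pred (j : ℕ) with h | h
      · simp [h]
      · generalize (j : ℕ).pred = t at h
        simp only [Nat.succ_eq_add_one] at h
        rw [h]
        simp only [Nat.add_right_cancel_iff, Finset.sum_ite_eq, Finset.mem_range]
        rw [if_pos (by omega), if_neg (by omega)]
        simp
    · rw [Finset.sum_ite_eq']
      split_ifs with h
      · rfl
      · rw [extendZero_of_lt p (by simpa using h), zero_mul]
  · rw [Finset.sum_ite_eq', if_pos (Finset.mem_range.2 j.2), extendZero_val]

/-- The stationary distribution of a birth–death chain from a detailed-balance weight. -/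
theorem isStationaryDist_birthDeath_iff {a b w : ℕ → ℝ} {n : ℕ} (hb0 : b 0 = 0)
    (hw : ∀ k, w (k + 1) * b (k + 1) = w k * a k) (hpos : ∀ k ≤ n, 0 < w k)
    (hzero : ∀ k, n < k → w k = 0) (hb : ∀ k < n, 0 < b (k + 1)) (p : Fin (n + 1) → ℝ) :
    IsStationaryDist (birthDeath a b n) p ↔
      p = fun k : Fin (n + 1) => w k / ∑ i : Fin (n + 1), w i := by
  have hS : 0 < ∑ i : Fin (n + 1), w i :=
    Finset.sum_pos (fun i _ => hpos i (Nat.lt_succ_iff.1 i.2)) Finset.univ_nonempty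
  constructor
  · rintro ⟨⟨-, hp1⟩, hp⟩
    -- Stationarity propagates from the left end: the net flow across each edge is zero, so
    -- stationarity implies detailed balance.
    have hbal : ∀ k ≤ n, extendZero p (k + 1) * b (k + 1) = extendZero p k * a k := by
      intro k
      induction k with
      | zero =>
        intro _
        have h := congrFun hp 0
        rw [vecMul_birthDeath] at h
        have e : extendZero p 0 = p 0 := extendZero_val p 0
        simp only [Fin.val_zero, if_true, hb0] at h
        rw [e]
        linarith
      | succ k ih =>
        intro hk
        have h := congrFun hp ⟨k + 1, by omega⟩
        rw [vecMul_birthDeath] at h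
        have e : extendZero p (k + 1) = p ⟨k + 1, by omega⟩ := extendZero_val p ⟨k + 1, by omega⟩
        simp only [Nat.succ_ne_zero, if_false, Nat.add_sub_cancel, ← e] at h
        have := ih (by omega)
        linarith
    have hprop : ∀ k ≤ n, extendZero p k = p 0 / w 0 * w k := by
      intro k
      induction k with
      | zero =>
        intro _
        have e : extendZero p 0 = p 0 := extendZero_val p 0
        rw [e, div_mul_cancel₀ _ (hpos 0 (Nat.zero_le _)).ne']
      | succ k ih =>
        intro hk
        have h1 := hbal k (by omega)
        rw [ih (by omega), mul_assoc, ← hw k, ← mul_assoc] at h1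
        exact mul_right_cancel₀ (hb k (by omega)).ne' h1
    have hpw : ∀ k, p k = p 0 / w 0 * w k := fun k => by
      rw [← hprop k (Nat.lt_succ_iff.1 k.2), extendZero_val]
    funext k
    have h1 : p 0 / w 0 * ∑ i : Fin (n + 1), w i = 1 := by
      rw [Finset.mul_sum, ← hp1]
      exact Finset.sum_congr rfl fun i _ => (hpw i).symm
    rw [hpw k, eq_div_iff hS.ne']
    linear_combination w k * h1
  · rintro rfl
    refine ⟨⟨fun k => div_nonneg (hpos k (Nat.lt_succ_iff.1 k.2)).le hS.le, ?_⟩, ?_⟩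
    · rw [← Finset.sum_div, div_self hS.ne']
    · have hext : ∀ k, extendZero (fun k : Fin (n + 1) => w k / ∑ i : Fin (n + 1), w i) k
          = w k / ∑ i : Fin (n + 1), w i := by
        intro k
        rcases Nat.lt_or_ge n k with h | h
        · rw [extendZero_of_lt _ h, hzero k h, zero_div]
        · exact extendZero_val _ (⟨k, by omega⟩ : Fin (n + 1))
      funext j
      rw [vecMul_birthDeath]
      simp only [hext]
      generalize (∑ i : Fin (n + 1), w i) = S
      rcases Nat.eq_zero_or_eq_succ_pred (j : ℕ) with h | h
      · have := hw 0
        rw [h, if_pos rfl, hb0]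
        linear_combination (1 / S) * this
      · generalize (j : ℕ).pred = t at h
        simp only [Nat.succ_eq_add_one] at h
        rw [h, if_neg (by omega), Nat.add_sub_cancel]
        linear_combination (1 / S) * hw (t + 1) - (1 / S) * hw t

/-! ### The magnetization chain -/

/-- The magnetization with `k` spins `+1`, for any natural number `k`. -/
def mag (n k : ℕ) : ℝ := (2 * (k : ℝ) - n) / n

/-- `eta` for any natural number `k`. -/
def etaNat (γ m₀ : ℝ) (n k : ℕ) : ℝ := (n : ℝ) ^ γ * (mag n k - m₀)

/-- The unnormalized stationary weight of the magnetization chain. -/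
def weight (γ m₀ β field : ℝ) (n k : ℕ) : ℝ :=
  n.choose k * Real.exp (-(β * Phi γ m₀ field n (etaNat γ m₀ n k)))

variable {γ m₀ β field : ℝ} {n : ℕ}

lemma mag_succ (n k : ℕ) : mag n (k + 1) = mag n k + 2 / n := by
  simp only [mag]; push_cast; ring

lemma mag_etaNat (hn : 1 ≤ n) (k : ℕ) :
    m₀ + (n : ℝ) ^ (-γ) * etaNat γ m₀ n k = mag n k := by
  have hn0 : (0 : ℝ) < n := by exact_mod_cast hn
  rw [etaNat, ← mul_assoc, ← Real.rpow_add hn0]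
  simp

lemma etaNat_succ (hn : 1 ≤ n) (k : ℕ) :
    etaNat γ m₀ n (k + 1) = etaNat γ m₀ n k + step γ n := by
  have hn0 : (0 : ℝ) < n := by exact_mod_cast hn
  rw [etaNat, etaNat, mag_succ, step, Real.rpow_sub_one hn0.ne']
  field_simp
  ring

/-- The energy is quadratic, so its increment is exactly the slope at the midpoint of the edge; this
is the origin of the shift `1 / n`. -/
lemma Phi_add_step (hn : 1 ≤ n) (η : ℝ) :
    Phi γ m₀ field n (η + step γ n)
      = Phi γ m₀ field n η - 2 * (m₀ + (n : ℝ) ^ (-γ) * η + field + 1 / n) := by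
  have hn0 : (0 : ℝ) < n := by exact_mod_cast hn
  have hg : (0 : ℝ) < (n : ℝ) ^ γ := Real.rpow_pos_of_pos hn0 γ
  have e1 : (n : ℝ) ^ (1 - 2 * γ) = n / ((n : ℝ) ^ γ) ^ 2 := by
    rw [Real.rpow_sub hn0, Real.rpow_one, mul_comm 2 γ, Real.rpow_mul hn0.le]
    norm_num
  have e2 : (n : ℝ) ^ (1 - γ) = n / (n : ℝ) ^ γ := by
    rw [Real.rpow_sub hn0, Real.rpow_one]
  rw [Phi, Phi, step, e1, e2, Real.rpow_sub_one hn0.ne', Real.rpow_neg hn0.le]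
  field_simp
  ring

lemma mag_le_one (hn : 1 ≤ n) {k : ℕ} (hk : k ≤ n) : |mag n k| ≤ 1 := by
  have hn0 : (0 : ℝ) < n := by exact_mod_cast hn
  have hk' : (k : ℝ) ≤ n := by exact_mod_cast hk
  have hk0 : (0 : ℝ) ≤ k := Nat.cast_nonneg k
  rw [mag, abs_div, abs_of_pos hn0, div_le_one hn0, abs_le]
  constructor <;> linarith

lemma pUp_etaNat (hn : 1 ≤ n) (k : ℕ) :
    pUp γ m₀ β field n (etaNat γ m₀ n k)
      = (1 - mag n k) / 2 * min 1 (Real.exp (2 * β * (mag n k + field + 1 / n))) := by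
  rw [pUp, proposalUp, Phi_add_step hn, mag_etaNat hn]
  congr 3
  ring

lemma pDown_etaNat_succ (hn : 1 ≤ n) (k : ℕ) :
    pDown γ m₀ β field n (etaNat γ m₀ n (k + 1))
      = (1 + mag n (k + 1)) / 2 *
        min 1 (Real.exp (-(2 * β * (mag n k + field + 1 / n)))) := by
  rw [pDown, proposalDown, mag_etaNat hn, etaNat_succ hn, add_sub_cancel_right, Phi_add_step hn,
    mag_etaNat hn]
  congr 3
  ring

lemma pDown_etaNat_zero (hn : 1 ≤ n) : pDown γ m₀ β field n (etaNat γ m₀ n 0) = 0 := by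
  have hn0 : (n : ℝ) ≠ 0 := by positivity
  rw [pDown, proposalDown, mag_etaNat hn, mag]
  simp [hn0]

lemma weight_pos {k : ℕ} (hk : k ≤ n) : 0 < weight γ m₀ β field n k :=
  mul_pos (by exact_mod_cast Nat.choose_pos hk) (Real.exp_pos _)

lemma weight_eq_zero {k : ℕ} (hk : n < k) : weight γ m₀ β field n k = 0 := by
  simp [weight, Nat.choose_eq_zero_of_lt hk]

lemma weight_succ (hn : 1 ≤ n) (k : ℕ) :
    weight γ m₀ β field n (k + 1) * (1 + mag n (k + 1))
      = weight γ m₀ β field n k * (1 - mag n k) *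
        Real.exp (2 * β * (mag n k + field + 1 / n)) := by
  have hn0 : (n : ℝ) ≠ 0 := by positivity
  have hchoose : (n.choose (k + 1) : ℝ) * (1 + mag n (k + 1)) = n.choose k * (1 - mag n k) := by
    have h1 : 1 + mag n (k + 1) = 2 * ((k : ℝ) + 1) / n := by
      rw [mag]; push_cast; field_simp; ring
    have h2 : 1 - mag n k = 2 * ((n : ℝ) - k) / n := by
      rw [mag]; field_simp; ring
    rw [h1, h2]
    rcases le_or_gt k n with h | h
    · have := Nat.choose_succ_right_eq n k
      have h3 : (n.choose (k + 1) : ℝ) * ((k : ℝ) + 1) = n.choose k * ((n : ℝ) - k) := by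
        rw [← Nat.cast_sub h]; exact_mod_cast this
      linear_combination (2 / (n : ℝ)) * h3
    · rw [Nat.choose_eq_zero_of_lt h, Nat.choose_eq_zero_of_lt (by omega)]; simp
  have hexp : Real.exp (-(β * Phi γ m₀ field n (etaNat γ m₀ n (k + 1))))
      = Real.exp (-(β * Phi γ m₀ field n (etaNat γ m₀ n k))) *
        Real.exp (2 * β * (mag n k + field + 1 / n)) := by
    rw [← Real.exp_add, etaNat_succ hn, Phi_add_step hn, mag_etaNat hn]
    congr 1; ring
  rw [weight, weight, hexp]
  linear_combination Real.exp (-(β * Phi γ m₀ field n (etaNat γ m₀ n k))) *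
        Real.exp (2 * β * (mag n k + field + 1 / n)) * hchoose

/-- The Metropolis identity `exp t * min 1 (exp (-t)) = min 1 (exp t)`. -/
lemma weight_detailed_balance (hn : 1 ≤ n) (k : ℕ) :
    weight γ m₀ β field n (k + 1) * pDown γ m₀ β field n (etaNat γ m₀ n (k + 1))
      = weight γ m₀ β field n k * pUp γ m₀ β field n (etaNat γ m₀ n k) := by
  rw [pUp_etaNat hn, pDown_etaNat_succ hn]
  have h := weight_succ (γ := γ) (m₀ := m₀) (β := β) (field := field) hn k
  set t := 2 * β * (mag n k + field + 1 / n)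
  have hmin : Real.exp t * min 1 (Real.exp (-t)) = min 1 (Real.exp t) := by
    rw [mul_min_of_nonneg _ _ (Real.exp_pos t).le, ← Real.exp_add, mul_one, min_comm]; simp
  rw [← hmin]
  linear_combination (min 1 (Real.exp (-t)) / 2) * h

lemma transition_eq_birthDeath (γ m₀ β field : ℝ) (n : ℕ) :
    transition γ m₀ β field n
      = birthDeath (fun k => pUp γ m₀ β field n (etaNat γ m₀ n k))
          (fun k => pDown γ m₀ β field n (etaNat γ m₀ n k)) n := rfl

theorem isStationaryDist_transition_iff (hn : 1 ≤ n) (p : Fin (n + 1) → ℝ) :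
    IsStationaryDist (transition γ m₀ β field n) p ↔
      p = fun k : Fin (n + 1) =>
        weight γ m₀ β field n k / ∑ i : Fin (n + 1), weight γ m₀ β field n i := by
  rw [transition_eq_birthDeath]
  refine isStationaryDist_birthDeath_iff (w := weight γ m₀ β field n) (pDown_etaNat_zero hn)
    (weight_detailed_balance hn) (fun k hk => weight_pos hk) (fun k hk => weight_eq_zero hk)
    (fun k hk => ?_) p
  simp only [pDown_etaNat_succ hn]
  refine mul_pos (half_pos ?_) (lt_min one_pos (Real.exp_pos _))
  have hn0 : (0 : ℝ) < n := by exact_mod_cast hn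
  have : 1 + mag n (k + 1) = 2 * ((k : ℝ) + 1) / n := by
    rw [mag]; push_cast; field_simp; ring
  rw [this]
  positivity

/-- Up-rate of a reversible dynamics for the Curie–Weiss magnetization. -/
def rateUp (β field m : ℝ) : ℝ := (1 - m) * Real.exp (β * (m + field))

/-- Down-rate of a reversible dynamics for the Curie–Weiss magnetization. -/
def rateDown (β field m : ℝ) : ℝ := (1 + m) * Real.exp (-(β * (m + field)))

/-- The midpoint exponent `2 β (m + field + 1 / n)` is the sum of `β (m + field)` at the two ends of
the edge. Each half can be assigned to one direction, giving smooth rates that depend on the current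
state alone. -/
lemma weight_rate_balance (hn : 1 ≤ n) (k : ℕ) :
    weight γ m₀ β field n (k + 1) * rateDown β field (mag n (k + 1))
      = weight γ m₀ β field n k * rateUp β field (mag n k) := by
  have h := weight_succ (γ := γ) (m₀ := m₀) (β := β) (field := field) hn k
  rw [rateUp, rateDown, ← mul_assoc, h, mul_assoc, ← Real.exp_add, ← mul_assoc]
  congr 2
  rw [mag_succ]
  ring

/-- Each edge contributes its upward and downward flows times `g` at the edge midpoint, and detailed
balance cancels them. Evaluating at midpoints is what makes the cancellation exact. -/
theorem stationary_stein_identity (hn : 1 ≤ n) {p : Fin (n + 1) → ℝ}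
    (hp : IsStationaryDist (transition γ m₀ β field n) p) (g : ℝ → ℝ) :
    ∑ k, p k * (rateUp β field (magnetization n k) * g (eta γ m₀ n k + step γ n / 2)
      - rateDown β field (magnetization n k) * g (eta γ m₀ n k - step γ n / 2)) = 0 := by
  rw [isStationaryDist_transition_iff hn] at hp
  have hn0 : (n : ℝ) ≠ 0 := by positivity
  generalize (∑ i : Fin (n + 1), weight γ m₀ β field n i) = S at hp
  have h1 : ∀ k, p k * (rateUp β field (magnetization n k) * g (eta γ m₀ n k + step γ n / 2)
      - rateDown β field (magnetization n k) * g (eta γ m₀ n k - step γ n / 2))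
      = (fun k : ℕ => (weight γ m₀ β field n k * rateUp β field (mag n k) *
            g (etaNat γ m₀ n k + step γ n / 2)) / S
          - (weight γ m₀ β field n k * rateDown β field (mag n k) *
            g (etaNat γ m₀ n k - step γ n / 2)) / S) k := by
    intro k
    rw [hp]
    change weight γ m₀ β field n k / S * (rateUp β field (mag n k) *
      g (etaNat γ m₀ n k + step γ n / 2) - rateDown β field (mag n k) *
      g (etaNat γ m₀ n k - step γ n / 2)) = _
    ring
  rw [Finset.sum_congr rfl fun k _ => h1 k, Fin.sum_univ_eq_sum_range (fun k : ℕ =>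
      (weight γ m₀ β field n k * rateUp β field (mag n k) *
            g (etaNat γ m₀ n k + step γ n / 2)) / S
          - (weight γ m₀ β field n k * rateDown β field (mag n k) *
            g (etaNat γ m₀ n k - step γ n / 2)) / S), Finset.sum_sub_distrib, sub_eq_zero,
    Finset.sum_range_succ, Finset.sum_range_succ' (n := n)]
  -- The two unpaired boundary terms vanish: no spin can flip up from magnetization `1`, nor down
  -- from `-1`.
  have hup : rateUp β field (mag n n) = 0 := by
    have : mag n n = 1 := by rw [mag]; field_simp; ring
    simp [rateUp, this]
  have hdown : rateDown β field (mag n 0) = 0 := by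
    have : mag n 0 = -1 := by rw [mag]; field_simp; simp
    simp [rateDown, this]
  rw [hup, hdown]
  simp only [mul_zero, zero_mul, zero_div, add_zero]
  refine Finset.sum_congr rfl fun k _ => ?_
  rw [weight_rate_balance hn, etaNat_succ hn]
  congr 3
  ring

/-! ### Taylor bounds on `[-1, 1]` -/

/-- Mean value inequality between `a` and `y`; iterating it raises the order of vanishing by one
each time, with a fixed constant. -/
lemma abs_le_pow_succ_of_deriv {F F' : ℝ → ℝ} {a C : ℝ} {k : ℕ} (hC0 : 0 ≤ C)
    (ha : |a| ≤ 1) (hF : ∀ y, HasDerivAt F (F' y) y)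
    (hC : ∀ y, |y| ≤ 1 → |F' y| ≤ C * |y - a| ^ k) (h0 : F a = 0) {y : ℝ} (hy : |y| ≤ 1) :
    |F y| ≤ C * |y - a| ^ (k + 1) := by
  have h := (convex_uIcc a y).norm_image_sub_le_of_norm_hasDerivWithin_le
    (f := F) (f' := F') (C := C * |y - a| ^ k) (fun z _ => (hF z).hasDerivWithinAt)
    (fun z hz => by
      have hz1 : |z| ≤ 1 := by
        rw [abs_le] at ha hy ⊢
        rcases mem_uIcc.1 hz with h | h <;> constructor <;> linarith
      refine (hC z hz1).trans (mul_le_mul_of_nonneg_left ?_ hC0)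
      exact pow_le_pow_left₀ (abs_nonneg _) (abs_sub_left_of_mem_uIcc hz) _)
    left_mem_uIcc right_mem_uIcc
  rw [h0, sub_zero, Real.norm_eq_abs, Real.norm_eq_abs] at h
  rw [pow_succ, ← mul_assoc]
  exact h

lemma exists_taylor_bound {f : ℝ → ℝ} (hf : ContDiff ℝ ∞ f) {a : ℝ} (ha : |a| ≤ 1) :
    ∃ C : ℝ, 0 ≤ C ∧ ∀ y, |y| ≤ 1 → |f y - f a| ≤ C * |y - a| ∧
      |f y - f a - deriv f a * (y - a)| ≤ C * |y - a| ^ 2 := by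
  have hf1 := contDiff_infty_iff_deriv.1 hf
  have hf2 := contDiff_infty_iff_deriv.1 hf1.2
  have hbd : ∀ g : ℝ → ℝ, Continuous g → ∃ C, ∀ y, |y| ≤ 1 → |g y| ≤ C := by
    intro g hg
    obtain ⟨C, hC⟩ := isCompact_Icc.exists_bound_of_continuousOn (s := Icc (-1 : ℝ) 1)
      hg.continuousOn
    exact ⟨C, fun y hy => hC y (abs_le.1 hy)⟩
  obtain ⟨C₁, h₁⟩ := hbd _ hf1.2.continuous
  obtain ⟨C₂, h₂⟩ := hbd _ hf2.2.continuous
  set C := max C₁ C₂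
  have hC0 : 0 ≤ C := ((abs_nonneg _).trans (h₁ a ha)).trans (le_max_left _ _)
  refine ⟨C, hC0, fun y hy => ⟨?_, ?_⟩⟩
  · have := abs_le_pow_succ_of_deriv (F := fun y => f y - f a) (k := 0) hC0 ha
      (fun y => (hf1.1 y).hasDerivAt.sub_const _)
      (fun y hy => by rw [pow_zero, mul_one]; exact (h₁ y hy).trans (le_max_left _ _)) (sub_self _) hy
    simpa using this
  · refine abs_le_pow_succ_of_deriv (F := fun y => f y - f a - deriv f a * (y - a))
      (F' := fun y => deriv f y - deriv f a) (k := 1) hC0 ha (fun y => ?_) (fun y hy => ?_)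
      (by simp) hy
    · refine (((hf1.1 y).hasDerivAt.sub_const _).fun_sub
        (((hasDerivAt_id y).sub_const a).const_mul (deriv f a))).congr_deriv (by simp)
    · have := abs_le_pow_succ_of_deriv (F := fun y => deriv f y - deriv f a) (k := 0) hC0 ha
        (fun y => (hf2.1 y).hasDerivAt.sub_const _)
        (fun y hy => by rw [pow_zero, mul_one]; exact (h₂ y hy).trans (le_max_right _ _)) (sub_self _) hy
      simpa using this

/-! ### Moments and scaling -/

/-- Foster–Lyapunov argument: averaging `T ≤ h (a - b y)` under a law with mean of `T` zero bounds
the mean of `y` by `a / b`; the scale `h` drops out. -/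
lemma sum_mul_le_of_sum_eq_zero {ι : Type*} [Fintype ι] {p T y W : ι → ℝ} {a b d h : ℝ}
    (hp : ∀ k, 0 ≤ p k) (hp1 : ∑ k, p k = 1) (hT : ∑ k, p k * T k = 0) (hh : 0 < h) (hb : 0 < b)
    (hd : 0 ≤ d) (hTy : ∀ k, T k ≤ h * (a - b * y k)) (hW : ∀ k, W k ≤ d * (1 + y k)) :
    ∑ k, p k * W k ≤ d * (1 + a / b) := by
  have h1 : (0 : ℝ) ≤ h * (a - b * ∑ k, p k * y k) := by
    calc (0 : ℝ) = ∑ k, p k * T k := hT.symm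
      _ ≤ ∑ k, p k * (h * (a - b * y k)) :=
          Finset.sum_le_sum fun k _ => mul_le_mul_of_nonneg_left (hTy k) (hp k)
      _ = h * (a * ∑ k, p k - b * ∑ k, p k * y k) := by
          simp only [Finset.mul_sum, ← Finset.sum_sub_distrib]
          exact Finset.sum_congr rfl fun k _ => by ring
      _ = _ := by rw [hp1, mul_one]
  have h2 : ∑ k, p k * y k ≤ a / b := by
    rw [le_div_iff₀ hb]
    have := nonneg_of_mul_nonneg_right h1 hh
    linarith
  calc ∑ k, p k * W k ≤ ∑ k, p k * (d * (1 + y k)) :=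
        Finset.sum_le_sum fun k _ => mul_le_mul_of_nonneg_left (hW k) (hp k)
    _ = d * (∑ k, p k + ∑ k, p k * y k) := by
        simp only [Finset.mul_sum, ← Finset.sum_add_distrib]
        exact Finset.sum_congr rfl fun k _ => by ring
    _ ≤ d * (1 + a / b) := by rw [hp1]; gcongr

lemma abs_magnetization_le_one {n : ℕ} (hn : 1 ≤ n) (k : Fin (n + 1)) : |magnetization n k| ≤ 1 :=
  mag_le_one hn (Nat.lt_succ_iff.1 k.2)

lemma magnetization_eq {γ m₀ : ℝ} {n : ℕ} (hn : 1 ≤ n) (k : Fin (n + 1)) :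
    magnetization n k = m₀ + (n : ℝ) ^ (-γ) * eta γ m₀ n k :=
  (mag_etaNat hn k).symm

lemma rpow_neg_pos_le_one {n : ℕ} (hn : 1 ≤ n) {γ : ℝ} (hγ : 0 ≤ γ) :
    0 < (n : ℝ) ^ (-γ) ∧ (n : ℝ) ^ (-γ) ≤ 1 :=
  ⟨Real.rpow_pos_of_pos (by exact_mod_cast hn) _,
    Real.rpow_le_one_of_one_le_of_nonpos (by exact_mod_cast hn) (by linarith)⟩

/-! ### Derivatives of the rates -/

lemma hasDerivAt_rateUp (β field m : ℝ) :
    HasDerivAt (rateUp β field) (β * rateUp β field m - Real.exp (β * (m + field))) m := by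
  have h1 : HasDerivAt (fun m : ℝ => β * (m + field)) β m := by
    simpa using ((hasDerivAt_id m).add_const field).const_mul β
  have h2 : HasDerivAt (fun m : ℝ => 1 - m) (-1) m := by
    simpa using (hasDerivAt_id m).const_sub 1
  refine (h2.fun_mul h1.exp).congr_deriv ?_
  rw [rateUp]; ring

lemma hasDerivAt_rateDown (β field m : ℝ) :
    HasDerivAt (rateDown β field)
      (-(β * rateDown β field m) + Real.exp (-(β * (m + field)))) m := by
  have h1 : HasDerivAt (fun m : ℝ => -(β * (m + field))) (-β) m := by
    simpa using (((hasDerivAt_id m).add_const field).const_mul β).fun_neg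
  have h2 : HasDerivAt (fun m : ℝ => 1 + m) 1 m := by
    simpa using (hasDerivAt_id m).const_add 1
  refine (h2.fun_mul h1.exp).congr_deriv ?_
  rw [rateDown]; ring

/-! ### The critical case -/

lemma hasDerivAt_critical_drift (m : ℝ) :
    HasDerivAt (fun m => rateUp 1 0 m - rateDown 1 0 m + 2 / 3 * m ^ 3)
      (-m * (Real.exp m - Real.exp (-m) - 2 * m)) m := by
  refine (((hasDerivAt_rateUp 1 0 m).fun_sub (hasDerivAt_rateDown 1 0 m)).fun_add
    ((hasDerivAt_pow 3 m).const_mul (2 / 3))).congr_deriv ?_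
  simp only [rateUp, rateDown, add_zero, one_mul]
  push_cast
  ring

lemma exp_add_exp_neg_le {m : ℝ} (hm : |m| ≤ 1) : Real.exp m + Real.exp (-m) ≤ 6 := by
  rw [abs_le] at hm
  have h1 : Real.exp m ≤ Real.exp 1 := Real.exp_le_exp.2 hm.2
  have h2 : Real.exp (-m) ≤ Real.exp 1 := Real.exp_le_exp.2 (by linarith)
  linarith [Real.exp_one_lt_d9]

/-- The drift is `2 (sinh m - m cosh m)`, and adding `2 / 3 * m ^ 3` leaves the derivative `-2 m
(sinh m - m)`. Its cubic vanishing follows by integrating up from `cosh`. -/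
lemma abs_critical_drift_le {m : ℝ} (hm : |m| ≤ 1) :
    |rateUp 1 0 m - rateDown 1 0 m + 2 / 3 * m ^ 3| ≤ 6 * |m| ^ 4 := by
  have h0 : |(0 : ℝ)| ≤ 1 := by simp
  have hneg : ∀ y : ℝ, HasDerivAt (fun y => Real.exp (-y)) (-Real.exp (-y)) y := fun y => by
    simpa using (hasDerivAt_id y).fun_neg.exp
  have hcosh : ∀ y : ℝ, |y| ≤ 1 → |Real.exp y + Real.exp (-y) - 2| ≤ 6 * |y - 0| ^ 1 := by
    intro y hy
    refine abs_le_pow_succ_of_deriv (F := fun y => Real.exp y + Real.exp (-y) - 2)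
      (F' := fun y => Real.exp y - Real.exp (-y)) (k := 0) (by norm_num) h0 (fun y => ?_)
      (fun y hy => ?_) (by norm_num) hy
    · refine (((Real.hasDerivAt_exp y).fun_add (hneg y)).sub_const 2).congr_deriv (by ring)
    · have h1 := exp_add_exp_neg_le hy
      have h2 := Real.exp_pos y
      have h3 := Real.exp_pos (-y)
      rw [pow_zero, mul_one, abs_le]
      constructor <;> linarith
  have hsinh : ∀ y : ℝ, |y| ≤ 1 → |Real.exp y - Real.exp (-y) - 2 * y| ≤ 6 * |y - 0| ^ 2 := by
    intro y hy
    refine abs_le_pow_succ_of_deriv (F := fun y => Real.exp y - Real.exp (-y) - 2 * y)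
      (F' := fun y => Real.exp y + Real.exp (-y) - 2) (k := 1) (by norm_num) h0 (fun y => ?_)
      hcosh (by norm_num) hy
    refine (((Real.hasDerivAt_exp y).fun_sub (hneg y)).fun_sub
      ((hasDerivAt_id y).const_mul 2)).congr_deriv (by ring)
  have := abs_le_pow_succ_of_deriv (k := 3) (by norm_num : (0 : ℝ) ≤ 6) h0
    hasDerivAt_critical_drift (fun y hy => ?_) (by simp [rateUp, rateDown]) hm
  · simpa using this
  · rw [abs_mul, abs_neg]
    calc |y| * |Real.exp y - Real.exp (-y) - 2 * y| ≤ |y| * (6 * |y - 0| ^ 2) :=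
          mul_le_mul_of_nonneg_left (hsinh y hy) (abs_nonneg _)
      _ = 6 * |y - 0| ^ 3 := by rw [sub_zero]; ring

lemma abs_critical_diffusivity_le {m : ℝ} (hm : |m| ≤ 1) :
    |rateUp 1 0 m + rateDown 1 0 m - 2| ≤ 6 * |m| := by
  have := abs_le_pow_succ_of_deriv (F := fun m => rateUp 1 0 m + rateDown 1 0 m - 2)
    (F' := fun m => -m * (Real.exp m + Real.exp (-m))) (a := 0) (C := 6) (k := 0) (by norm_num)
    (by simp) (fun y => ?_) (fun y hy => ?_) (by simp [rateUp, rateDown]; norm_num) hm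
  · simpa using this
  · refine (((hasDerivAt_rateUp 1 0 y).fun_add (hasDerivAt_rateDown 1 0 y)).sub_const
      2).congr_deriv ?_
    simp only [rateUp, rateDown, add_zero, one_mul]
    ring
  · have h2 : 0 ≤ Real.exp y + Real.exp (-y) := by positivity
    rw [abs_mul, abs_neg, abs_of_nonneg h2, pow_zero, mul_one]
    have := mul_le_mul hy (exp_add_exp_neg_le hy) h2 zero_le_one
    linarith

/-- The derivative `-2 m (sinh m - m)` is nonpositive for every `m`, so the cubic term bounds the
drift globally, not only to leading order. -/
lemma critical_drift_mul_le (m : ℝ) :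
    (rateUp 1 0 m - rateDown 1 0 m) * m ≤ -(2 / 3) * m ^ 4 := by
  have hanti : Antitone fun m : ℝ => rateUp 1 0 m - rateDown 1 0 m + 2 / 3 * m ^ 3 := by
    refine antitone_of_deriv_nonpos (fun m => (hasDerivAt_critical_drift m).differentiableAt)
      fun m => ?_
    rw [(hasDerivAt_critical_drift m).deriv]
    have hs : Real.exp m - Real.exp (-m) = 2 * Real.sinh m := by rw [Real.sinh_eq]; ring
    rw [hs]
    rcases le_total 0 m with h | h
    · nlinarith [Real.self_le_sinh_iff.2 h]
    · nlinarith [Real.sinh_le_self_iff.2 h]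
  have h0 : rateUp 1 0 0 - rateDown 1 0 0 + 2 / 3 * (0 : ℝ) ^ 3 = 0 := by simp [rateUp, rateDown]
  have key : (rateUp 1 0 m - rateDown 1 0 m + 2 / 3 * m ^ 3) * m ≤ 0 := by
    rcases le_total 0 m with h | h
    · have := hanti h
      simp only [h0] at this
      exact mul_nonpos_of_nonpos_of_nonneg this h
    · have := hanti h
      simp only [h0] at this
      exact mul_nonpos_of_nonneg_of_nonpos this h
  linarith

theorem critical_bound : ∃ C : ℝ, ∀ n : ℕ, 1 ≤ n → ∀ p : Fin (n + 1) → ℝ,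
    IsStationaryDist (transition (1 / 4) 0 1 0 n) p →
    ∀ (φ : ℝ → ℝ) (M : ℝ) (K : ℝ≥0), (∀ x, |φ x| ≤ M) → LipschitzWith K φ →
      |∑ k, p k * φ (eta (1 / 4) 0 n k) - ∫ y, φ y ∂(gibbs (1 / 12) 1)|
        ≤ C * (M + K) / (n : ℝ) ^ (1 / 4 : ℝ) := by
  -- With `κ = 1` and `h = ε ^ 3`, `L = 3` turns the allowed errors into `6 ε ^ 4` and `6 ε`,
  -- matching the Taylor constants. The last argument is the sixth-moment bound `d (1 + a / b)` with
  -- `d = 32`, `a = 100`, `b = 1 / 3`.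
  obtain ⟨C, hC⟩ := stein_comparison (c := 1 / 12) (by norm_num) 1 (L := 3) (by norm_num)
    (32 * (1 + 100 / (1 / 3)))
  refine ⟨C, fun n hn p hp φ M K hM hK => ?_⟩
  have hn0 : (0 : ℝ) < n := by exact_mod_cast hn
  obtain ⟨hε0, hε1⟩ := rpow_neg_pos_le_one hn (γ := 1 / 4) (by norm_num)
  have hmag := fun k : Fin (n + 1) => magnetization_eq (γ := 1 / 4) (m₀ := 0) hn k
  have hstep : step (1 / 4) n / 2 = ((n : ℝ) ^ (-(1 / 4) : ℝ)) ^ 3 := by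
    rw [step, ← Real.rpow_natCast, ← Real.rpow_mul hn0.le]
    norm_num
  have hid := stationary_stein_identity hn hp
  have hdiv : C * (M + K) / (n : ℝ) ^ (1 / 4 : ℝ) = C * (M + K) * (n : ℝ) ^ (-(1 / 4) : ℝ) := by
    rw [Real.rpow_neg hn0.le, div_eq_mul_inv]
  rw [hdiv]
  simp only [hstep] at hid
  set ε := (n : ℝ) ^ (-(1 / 4) : ℝ)
  have hh1 : ε ^ 3 ≤ 1 := pow_le_one₀ hε0.le hε1
  have hm1 := abs_magnetization_le_one hn
  refine hC n p _ (fun k => rateUp 1 0 (magnetization n k))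
    (fun k => rateDown 1 0 (magnetization n k)) 1 (ε ^ 3) ε hp.1.1 hp.1.2 one_pos (by positivity) hh1
    (pow_le_of_le_one hε0.le hε1 (by norm_num)) (fun k => ?_) (fun k => ?_) hid ?_ φ M K hM hK
  · have h1 := abs_critical_drift_le (hm1 k)
    have h2 : |eta (1 / 4) 0 n k| ^ 4 ≤ growth 1 (eta (1 / 4) 0 n k) ^ 2 := by
      rw [growth, ← pow_mul]
      have h3 := abs_nonneg (eta (1 / 4) 0 n k)
      refine (pow_le_pow_left₀ h3 (by linarith : _ ≤ 1 + |eta (1 / 4) 0 n k|) 4).trans ?_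
      exact pow_le_pow_right₀ (by linarith) (by norm_num)
    have e1 : 2 * 1 * ε ^ 3 * force (1 / 12) 1 (eta (1 / 4) 0 n k)
        = 2 / 3 * magnetization n k ^ 3 := by
      rw [hmag k, force]; push_cast; ring
    rw [e1]
    refine h1.trans ?_
    rw [hmag k, zero_add, abs_mul, abs_of_pos hε0, mul_pow]
    have : ε ^ 4 * |eta (1 / 4) 0 n k| ^ 4 ≤ ε ^ 4 * growth 1 (eta (1 / 4) 0 n k) ^ 2 :=
      mul_le_mul_of_nonneg_left h2 (by positivity)
    linarith
  · have h1 := abs_critical_diffusivity_le (hm1 k)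
    have h2 : |eta (1 / 4) 0 n k| ≤ growth 1 (eta (1 / 4) 0 n k) := by
      have h3 := abs_nonneg (eta (1 / 4) 0 n k)
      have : 1 + |eta (1 / 4) 0 n k| ≤ growth 1 (eta (1 / 4) 0 n k) :=
        le_self_pow₀ (by linarith) (by norm_num)
      linarith
    rw [mul_one]
    refine h1.trans ?_
    have e : |magnetization n k| = ε * |eta (1 / 4) 0 n k| := by
      rw [hmag k, zero_add, abs_mul, abs_of_pos hε0]
    rw [e]
    have := mul_le_mul_of_nonneg_left h2 hε0.le
    linarith
  -- Testing with `x ^ 3` pairs with the cubic drift to control the sixth moment, the degree of the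
  -- squared weight.
  · refine sum_mul_le_of_sum_eq_zero (y := fun k => eta (1 / 4) 0 n k ^ 6) hp.1.1 hp.1.2
      (hid fun x => x ^ 3) (by positivity : 0 < ε ^ 3) (by norm_num) (by norm_num)
      (fun k => ?_) (fun k => ?_)
    · have h1 := critical_drift_mul_le (magnetization n k)
      have h2 := (le_abs_self _).trans (abs_critical_diffusivity_le (hm1 k))
      have h3 := hm1 k
      have h4 : rateUp 1 0 (magnetization n k) + rateDown 1 0 (magnetization n k) ≤ 8 := by linarith
      set x := eta (1 / 4) 0 n k with hx
      have hmx : magnetization n k = ε * x := by rw [hmag k, zero_add]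
      set A := rateUp 1 0 (magnetization n k)
      set B := rateDown 1 0 (magnetization n k)
      rw [hmx] at h1
      have h5 : (A - B) * x ≤ -(2 / 3) * (ε ^ 3 * x ^ 4) := by
        refine le_of_mul_le_mul_left ?_ hε0
        linarith
      have h6 : (A - B) * x * (x ^ 2 + 3 * (ε ^ 3) ^ 2)
          ≤ -(2 / 3) * (ε ^ 3 * x ^ 4) * (x ^ 2 + 3 * (ε ^ 3) ^ 2) :=
        mul_le_mul_of_nonneg_right h5 (by positivity)
      have h7 : 0 ≤ ε ^ 3 * x ^ 4 * (ε ^ 3) ^ 2 := by positivity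
      have h8 : (A + B) * (ε ^ 3 * (3 * x ^ 2 + (ε ^ 3) ^ 2)) ≤ 8 * (ε ^ 3 * (3 * x ^ 2 + 1)) := by
        have h9 : (ε ^ 3) ^ 2 ≤ 1 := pow_le_one₀ (by positivity) hh1
        have h10 : ε ^ 3 * (3 * x ^ 2 + (ε ^ 3) ^ 2) ≤ ε ^ 3 * (3 * x ^ 2 + 1) := by gcongr
        have h11 : 0 ≤ ε ^ 3 * (3 * x ^ 2 + (ε ^ 3) ^ 2) := by positivity
        exact (mul_le_mul_of_nonneg_right h4 h11).trans
          (mul_le_mul_of_nonneg_left h10 (by norm_num))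
      have h12 : 8 * (3 * x ^ 2 + 1) ≤ 100 + 1 / 3 * x ^ 6 := by
        have ht : 0 ≤ x ^ 2 := sq_nonneg x
        have e6 : x ^ 6 = (x ^ 2) ^ 3 := by ring
        rw [e6]
        generalize x ^ 2 = t at ht
        -- With `t = x ^ 2`, the hint is `(t + 10) (t - 5) ^ 2 = t ^ 3 - 75 t + 250`, which has no
        -- quadratic term.
        nlinarith [mul_nonneg (by linarith : 0 ≤ t + 10) (sq_nonneg (t - 5))]
      have h13 := mul_le_mul_of_nonneg_left h12 (by positivity : 0 ≤ ε ^ 3)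
      have e : A * (x + ε ^ 3) ^ 3 - B * (x - ε ^ 3) ^ 3
          = (A - B) * x * (x ^ 2 + 3 * (ε ^ 3) ^ 2)
            + (A + B) * (ε ^ 3 * (3 * x ^ 2 + (ε ^ 3) ^ 2)) := by ring
      rw [e]
      linarith
    -- Convexity: `(1 + |x|) ^ 6 ≤ 2 ^ 5 (1 + x ^ 6)`.
    · have h1 := add_pow_le zero_le_one (abs_nonneg (eta (1 / 4) 0 n k)) 6
      rw [Even.pow_abs (by decide : Even 6)] at h1
      rw [growth, ← pow_mul]
      norm_num at h1 ⊢
      exact h1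

/-! ### The supercritical case -/

lemma contDiff_rateUp (β field : ℝ) : ContDiff ℝ ∞ (rateUp β field) := by
  unfold rateUp; fun_prop

lemma contDiff_rateDown (β field : ℝ) : ContDiff ℝ ∞ (rateDown β field) := by
  unfold rateDown; fun_prop

section Supercritical

variable {β field m₀ : ℝ}

/-- The mean-field equation says precisely that the drift vanishes at `m₀`; the common rate is the
`κ` of the comparison. -/
lemma rateUp_eq_rateDown (hm : m₀ = Real.tanh (β * (m₀ + field))) :
    rateUp β field m₀ = rateDown β field m₀ := by
  have h1 : m₀ * Real.cosh (β * (m₀ + field)) = Real.sinh (β * (m₀ + field)) := by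
    rw [← eq_div_iff (Real.cosh_pos _).ne', ← Real.tanh_eq_sinh_div_cosh]; exact hm
  rw [Real.cosh_eq, Real.sinh_eq] at h1
  rw [rateUp, rateDown]
  linarith

lemma abs_lt_one_of_eq_tanh (hm : m₀ = Real.tanh (β * (m₀ + field))) : |m₀| < 1 := by
  rw [hm]; exact Real.abs_tanh_lt_one _

lemma rateUp_pos (hm : |m₀| < 1) : 0 < rateUp β field m₀ :=
  mul_pos (by linarith [(abs_lt.1 hm).2]) (Real.exp_pos _)

/-- Divided by `-2 κ`, this slope is the coefficient of the limiting linear force. The rates thus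
reproduce the required Gaussian without the factor `1 - |m₀|`, which is only a time scale. -/
lemma deriv_rate_sub (hm : m₀ = Real.tanh (β * (m₀ + field))) :
    deriv (fun m => rateUp β field m - rateDown β field m) m₀
      = -(2 * rateUp β field m₀ * (1 / (1 - m₀ ^ 2) - β)) := by
  rw [((hasDerivAt_rateUp β field m₀).fun_sub (hasDerivAt_rateDown β field m₀)).deriv]
  have habs := abs_lt.1 (abs_lt_one_of_eq_tanh hm)
  have h1 : 1 - m₀ ≠ 0 := by linarith [habs.2]
  have h2 : 1 + m₀ ≠ 0 := by linarith [habs.1]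
  have hAB := rateUp_eq_rateDown hm
  have e1 : Real.exp (β * (m₀ + field)) = rateUp β field m₀ / (1 - m₀) := by
    rw [rateUp]; field_simp
  have e2 : Real.exp (-(β * (m₀ + field))) = rateUp β field m₀ / (1 + m₀) := by
    rw [hAB, rateDown]; field_simp
  have h3 : 1 - m₀ ^ 2 ≠ 0 := by
    have : 1 - m₀ ^ 2 = (1 - m₀) * (1 + m₀) := by ring
    rw [this]; exact mul_ne_zero h1 h2
  rw [← hAB, e1, e2]
  field_simp
  ring

lemma antitone_tanh_sub (hβ : 0 ≤ β) :
    Antitone fun m : ℝ => Real.tanh (β * (m + field)) - β * m := by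
  have hd : ∀ m : ℝ, HasDerivAt (fun m : ℝ => Real.tanh (β * (m + field)) - β * m)
      (β / Real.cosh (β * (m + field)) ^ 2 - β) m := by
    intro m
    have h1 : HasDerivAt (fun m : ℝ => β * (m + field)) β m := by
      simpa using ((hasDerivAt_id m).add_const field).const_mul β
    simp only [Real.tanh_eq_sinh_div_cosh]
    refine ((h1.sinh.fun_div h1.cosh (Real.cosh_pos _).ne').fun_sub
      ((hasDerivAt_id m).const_mul β)).congr_deriv ?_
    have h2 := Real.cosh_sq (β * (m + field))
    have h3 := Real.cosh_pos (β * (m + field))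
    field_simp
    linear_combination β * h2
  refine antitone_of_deriv_nonpos (fun m => (hd m).differentiableAt) fun m => ?_
  rw [(hd m).deriv, sub_nonpos]
  exact div_le_self hβ (one_le_pow₀ (Real.one_le_cosh _))

/-- The drift equals `2 cosh (β (m + field))` times `tanh (β (m + field)) - m`. As `tanh` is
1-Lipschitz, the second factor decreases at rate at least `1 - β` from its zero `m₀`, and `cosh ≥ 1`
can only help. -/
lemma supercritical_drift_mul_le (hβ : 0 ≤ β) (hβ1 : β < 1)
    (hm : m₀ = Real.tanh (β * (m₀ + field))) (m : ℝ) :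
    (rateUp β field m - rateDown β field m) * (m - m₀) ≤ -(2 * (1 - β)) * (m - m₀) ^ 2 := by
  have hcosh := Real.one_le_cosh (β * (m + field))
  have hsinh : Real.sinh (β * (m + field))
      = Real.tanh (β * (m + field)) * Real.cosh (β * (m + field)) := by
    rw [Real.tanh_eq_sinh_div_cosh, div_mul_cancel₀ _ (Real.cosh_pos _).ne']
  have e : rateUp β field m - rateDown β field m
      = 2 * Real.cosh (β * (m + field)) * (Real.tanh (β * (m + field)) - m) := by
    have h2 : 2 * Real.cosh (β * (m + field)) * (Real.tanh (β * (m + field)) - m)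
        = 2 * (Real.sinh (β * (m + field)) - m * Real.cosh (β * (m + field))) := by
      rw [hsinh]; ring
    rw [h2, Real.sinh_eq, Real.cosh_eq, rateUp, rateDown]; ring
  have hanti := antitone_tanh_sub (field := field) hβ
  have h1 : (Real.tanh (β * (m + field)) - m) * (m - m₀) ≤ -(1 - β) * (m - m₀) ^ 2 := by
    rcases le_total m₀ m with h | h
    · have := hanti h
      simp only [← hm] at this
      nlinarith
    · have := hanti h
      simp only [← hm] at this
      nlinarith
  rw [e]
  have h3 : 0 ≤ (1 - β) * (m - m₀) ^ 2 := mul_nonneg (by linarith) (sq_nonneg _)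
  nlinarith

theorem supercritical_bound (hβ : 0 ≤ β) (hβ1 : β < 1)
    (hm : m₀ = Real.tanh (β * (m₀ + field))) :
    ∃ C : ℝ, ∀ n : ℕ, 1 ≤ n → ∀ p : Fin (n + 1) → ℝ,
    IsStationaryDist (transition (1 / 2) m₀ β field n) p →
    ∀ (φ : ℝ → ℝ) (M : ℝ) (K : ℝ≥0), (∀ x, |φ x| ≤ M) → LipschitzWith K φ →
      |∑ k, p k * φ (eta (1 / 2) m₀ n k)
          - ∫ y, φ y ∂(gibbs ((1 / (1 - m₀ ^ 2) - β) / 2) 0)|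
        ≤ C * (M + K) / (n : ℝ) ^ (1 / 2 : ℝ) := by
  have habs := abs_lt_one_of_eq_tanh hm
  have hκ : 0 < rateUp β field m₀ := rateUp_pos habs
  have hAB0 := rateUp_eq_rateDown hm
  have hderiv := deriv_rate_sub hm
  have hs : 0 < 1 / (1 - m₀ ^ 2) - β := by
    have h1 : 0 < 1 - m₀ ^ 2 := by
      have := (sq_lt_one_iff_abs_lt_one m₀).2 habs
      linarith
    have h2 : 1 ≤ 1 / (1 - m₀ ^ 2) := by
      rw [le_div_iff₀ h1]; linarith [sq_nonneg m₀]
    linarith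
  obtain ⟨L₁, hL₁, hD⟩ := exists_taylor_bound
    ((contDiff_rateUp β field).sub (contDiff_rateDown β field)) habs.le
  obtain ⟨L₂, hL₂, hE⟩ := exists_taylor_bound
    ((contDiff_rateUp β field).add (contDiff_rateDown β field)) habs.le
  simp only [hAB0, sub_self, sub_zero] at hD
  rw [← hAB0] at hE
  rw [hderiv] at hD
  set s := 1 / (1 - m₀ ^ 2) - β
  set κ := rateUp β field m₀ with hκdef
  -- Dividing by `2 κ` normalizes the Taylor constants of drift and diffusivity; the last argument
  -- is the second-moment bound `d (1 + a / b)` with `d = 2`, `a = 2 κ + 2 L₂` and `b = 2 (1 - β)`.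
  obtain ⟨C, hC⟩ := stein_comparison (c := s / 2) (by positivity) 0 (L := (L₁ + L₂) / (2 * κ))
    (by positivity) (2 * (1 + (2 * κ + 2 * L₂) / (2 * (1 - β))))
  refine ⟨C, fun n hn p hp φ M K hM hK => ?_⟩
  have hn0 : (0 : ℝ) < n := by exact_mod_cast hn
  obtain ⟨hε0, hε1⟩ := rpow_neg_pos_le_one hn (γ := 1 / 2) (by norm_num)
  have hmag := fun k : Fin (n + 1) => magnetization_eq (γ := 1 / 2) (m₀ := m₀) hn k
  have hstep : step (1 / 2) n / 2 = (n : ℝ) ^ (-(1 / 2) : ℝ) := by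
    rw [step]; norm_num
  have hid := stationary_stein_identity hn hp
  have hdiv : C * (M + K) / (n : ℝ) ^ (1 / 2 : ℝ) = C * (M + K) * (n : ℝ) ^ (-(1 / 2) : ℝ) := by
    rw [Real.rpow_neg hn0.le, div_eq_mul_inv]
  rw [hdiv]
  simp only [hstep] at hid
  set ε := (n : ℝ) ^ (-(1 / 2) : ℝ)
  have hm1 := abs_magnetization_le_one hn
  have hsub : ∀ k : Fin (n + 1), magnetization n k - m₀ = ε * eta (1 / 2) m₀ n k := fun k => by
    rw [hmag k]; ring
  have hgrow : ∀ x : ℝ, |x| ≤ growth 0 x := fun x => by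
    rw [growth]; norm_num
  refine hC n p _ (fun k => rateUp β field (magnetization n k))
    (fun k => rateDown β field (magnetization n k)) κ ε ε hp.1.1 hp.1.2 hκ hε0 hε1 le_rfl
    (fun k => ?_) (fun k => ?_) hid ?_ φ M K hM hK
  · have h1 := (hD _ (hm1 k)).2
    rw [hsub k] at h1
    set x := eta (1 / 2) m₀ n k
    have e1 : 2 * κ * ε * force (s / 2) 0 x = 2 * κ * s * (ε * x) := by
      rw [force]; push_cast; ring
    have e2 : 2 * κ * ε * ((L₁ + L₂) / (2 * κ) * ε * growth 0 x ^ 2)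
        = (L₁ + L₂) * (ε ^ 2 * growth 0 x ^ 2) := by field_simp
    have h2 : |ε * x| ^ 2 ≤ ε ^ 2 * growth 0 x ^ 2 := by
      rw [abs_mul, abs_of_pos hε0, mul_pow]
      have := hgrow x
      gcongr
    rw [e1, e2]
    have e3 : rateUp β field (magnetization n k) - rateDown β field (magnetization n k)
        - -(2 * κ * s) * (ε * x) = rateUp β field (magnetization n k)
        - rateDown β field (magnetization n k) + 2 * κ * s * (ε * x) := by ring
    rw [e3] at h1
    refine h1.trans ?_
    have h3 := mul_le_mul_of_nonneg_left h2 hL₁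
    have h4 : 0 ≤ L₂ * (ε ^ 2 * growth 0 x ^ 2) := by positivity
    linarith
  · have h1 := (hE _ (hm1 k)).1
    rw [hsub k, abs_mul, abs_of_pos hε0] at h1
    set x := eta (1 / 2) m₀ n k
    have e2 : 2 * κ * ((L₁ + L₂) / (2 * κ) * ε * growth 0 x)
        = (L₁ + L₂) * (ε * growth 0 x) := by field_simp
    rw [e2, two_mul]
    refine h1.trans ?_
    have h2 := mul_le_mul_of_nonneg_left (mul_le_mul_of_nonneg_left (hgrow x) hε0.le) hL₂
    have h3 : 0 ≤ L₁ * (ε * growth 0 x) := by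
      have := one_le_growth 0 x
      positivity
    linarith
  -- With `g = x` the summand is `(A - B) x + ε (A + B)`: dissipation against a bounded diffusivity.
  · refine sum_mul_le_of_sum_eq_zero (y := fun k => eta (1 / 2) m₀ n k ^ 2) hp.1.1 hp.1.2
      (hid fun x => x) hε0 (by linarith) (by norm_num) (fun k => ?_) (fun k => ?_)
    · have h1 := supercritical_drift_mul_le hβ hβ1 hm (magnetization n k)
      have h2 := (le_abs_self _).trans (hE _ (hm1 k)).1
      have h3 : |magnetization n k - m₀| ≤ 2 := by
        have := abs_sub (magnetization n k) m₀
        linarith [hm1 k]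
      have h4 := mul_le_mul_of_nonneg_left h3 hL₂
      rw [hsub k] at h1
      set x := eta (1 / 2) m₀ n k
      set A := rateUp β field (magnetization n k)
      set B := rateDown β field (magnetization n k)
      have h5 : A + B ≤ 2 * κ + 2 * L₂ := by linarith
      have h6 : (A - B) * x ≤ -(2 * (1 - β)) * (ε * x ^ 2) := by
        refine le_of_mul_le_mul_left ?_ hε0
        linarith
      have h7 := mul_le_mul_of_nonneg_right h5 hε0.le
      linarith
    · rw [growth]
      have h1 := sq_abs (eta (1 / 2) m₀ n k)
      norm_num
      nlinarith [sq_nonneg (1 - |eta (1 / 2) m₀ n k|)]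

end Supercritical

/-! ### The limiting diffusions -/

lemma isStationaryLaw_critical_iff (ν : Measure ℝ) :
    IsStationaryLaw criticalDiffusivity criticalDrift ν ↔ ν = gibbs (1 / 12) 1 := by
  have h1 : criticalDiffusivity = fun _ => 2 * 2 := by
    funext x; rw [criticalDiffusivity]; norm_num
  have h2 : criticalDrift = fun x => -2 * force (1 / 12) 1 x := by
    funext x; rw [criticalDrift, force]; push_cast; ring
  rw [h1, h2]
  exact isStationaryLaw_iff two_ne_zero (by norm_num) 1 ν

lemma isStationaryLaw_supercritical_iff {β m₀ : ℝ} (hβ1 : β < 1) (hm : |m₀| < 1) (ν : Measure ℝ) :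
    IsStationaryLaw (supercriticalDiffusivity m₀) (supercriticalDrift β m₀) ν ↔
      ν = gibbs ((1 / (1 - m₀ ^ 2) - β) / 2) 0 := by
  have h1 : supercriticalDiffusivity m₀ = fun _ => 2 * (2 * (1 - |m₀|)) := by
    funext x; rw [supercriticalDiffusivity]; ring
  have h2 : supercriticalDrift β m₀
      = fun x => -(2 * (1 - |m₀|)) * force ((1 / (1 - m₀ ^ 2) - β) / 2) 0 x := by
    funext x; rw [supercriticalDrift, force]; push_cast; ring
  have hs : 0 < 1 / (1 - m₀ ^ 2) - β := by
    have h1 : 0 < 1 - m₀ ^ 2 := by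
      have := (sq_lt_one_iff_abs_lt_one m₀).2 hm
      linarith
    have h2 : 1 ≤ 1 / (1 - m₀ ^ 2) := by
      rw [le_div_iff₀ h1]; linarith [sq_nonneg m₀]
    linarith
  rw [h1, h2]
  exact isStationaryLaw_iff (by linarith : 2 * (1 - |m₀|) ≠ 0) (by positivity) 0 ν

lemma existsUnique_isStationaryDist {γ m₀ β field : ℝ} {n : ℕ} (hn : 1 ≤ n) :
    ∃! p : Fin (n + 1) → ℝ, IsStationaryDist (transition γ m₀ β field n) p := by
  simp only [isStationaryDist_transition_iff hn]
  exact existsUnique_eq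

end CurieWeiss

end

open CurieWeiss in
theorem mainTheorem1 :
    -- critical case: `β = 1`, no external field, `m₀ = 0`, `γ = 1/4`
    ((∃! ν : Measure ℝ, IsStationaryLaw criticalDiffusivity criticalDrift ν) ∧
      (∀ n : ℕ, 1 ≤ n →
        ∃! p : Fin (n + 1) → ℝ, IsStationaryDist (transition (1 / 4) 0 1 0 n) p) ∧
      ∃ C : ℝ, ∀ n : ℕ, 1 ≤ n →
        ∀ (p : Fin (n + 1) → ℝ) (ν : Measure ℝ),
          IsStationaryDist (transition (1 / 4) 0 1 0 n) p →
          IsStationaryLaw criticalDiffusivity criticalDrift ν →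
          ∀ (φ : ℝ → ℝ) (M : ℝ) (K : ℝ≥0), (∀ x, |φ x| ≤ M) → LipschitzWith K φ →
            |∑ k, p k * φ (eta (1 / 4) 0 n k) - ∫ y, φ y ∂ν|
              ≤ C * (M + K) / (n : ℝ) ^ (1 / 4 : ℝ)) ∧
    -- supercritical case: `0 ≤ β < 1`, any external field, `γ = 1/2`
    (∀ β field m₀ : ℝ, 0 ≤ β → β < 1 → m₀ = Real.tanh (β * (m₀ + field)) →
      (∃! ν : Measure ℝ,
        IsStationaryLaw (supercriticalDiffusivity m₀) (supercriticalDrift β m₀) ν) ∧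
      (∀ n : ℕ, 1 ≤ n →
        ∃! p : Fin (n + 1) → ℝ, IsStationaryDist (transition (1 / 2) m₀ β field n) p) ∧
      ∃ C : ℝ, ∀ n : ℕ, 1 ≤ n →
        ∀ (p : Fin (n + 1) → ℝ) (ν : Measure ℝ),
          IsStationaryDist (transition (1 / 2) m₀ β field n) p →
          IsStationaryLaw (supercriticalDiffusivity m₀) (supercriticalDrift β m₀) ν →
          ∀ (φ : ℝ → ℝ) (M : ℝ) (K : ℝ≥0), (∀ x, |φ x| ≤ M) → LipschitzWith K φ →
            |∑ k, p k * φ (eta (1 / 2) m₀ n k) - ∫ y, φ y ∂ν|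
              ≤ C * (M + K) / (n : ℝ) ^ (1 / 2 : ℝ)) := by
  refine ⟨⟨?_, fun n hn => existsUnique_isStationaryDist hn, ?_⟩, fun β field m₀ hβ hβ1 hm =>
    ⟨?_, fun n hn => existsUnique_isStationaryDist hn, ?_⟩⟩
  · simp only [isStationaryLaw_critical_iff]
    exact existsUnique_eq
  · obtain ⟨C, hC⟩ := critical_bound
    refine ⟨C, fun n hn p ν hp hν => ?_⟩
    rw [isStationaryLaw_critical_iff] at hν
    subst hν
    exact hC n hn p hp
  · simp only [isStationaryLaw_supercritical_iff hβ1 (abs_lt_one_of_eq_tanh hm)]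
    exact existsUnique_eq
  · obtain ⟨C, hC⟩ := supercritical_bound hβ hβ1 hm
    refine ⟨C, fun n hn p ν hp hν => ?_⟩
    rw [isStationaryLaw_supercritical_iff hβ1 (abs_lt_one_of_eq_tanh hm)] at hν
    subst hν
    exact hC n hn p hp
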